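/- **The calculus $\mathcal L_{rec}$.** Linear types are $A,B::=\mathsf{nat}\mid A\multimap B\mid A\otimes B$. Terms, taken modulo $\alpha$-equivalence, are $$t,u,v,w::=x\mid 0\mid \mathsf S\,t\mid \mathsf{rec}\;t\;u\;v\;w\mid tu\mid\lambda x.t\mid\langle t,u\rangle\mid \mathsf{let}\;t=\langle x,y\rangle\;\mathsf{in}\;u ,$$ subject to syntactic linearity: the immediate subterms of $tu$, $\langle t,u\rangle$, $\mathsf{rec}\,t\,u\,v\,w$ have pairwise disjoint sets of free variables, $x\in \mathrm{fv}(t)$ in $\lambda x.t$, and $x,y\in \mathrm{fv}(u)$, $\mathrm{fv}(t)\cap(\mathrm{fv}(u)\setminus\{x,y\})=\varnothing$ in $\mathsf{let}\;t=\langle x,y\rangle\;\mathsf{in}\;u$. Closed reduction $\to$ is generated, in arbitrary contexts, by - $(\lambda x.t)v\to t[v/x]$ if $v$ is closed; - $\mathsf{let}\;\langle t,u\rangle=\langle x,y\rangle\;\mathsf{in}\;v\to v[t/x][u/y]$ if $t,u$ are closed; - $\mathsf{rec}\,\langle 0,t'\rangle\,u\,v\,w\to u$ if $t',v,w$ are closed;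 - $\mathsf{rec}\,\langle \mathsf S t,t'\rangle\,u\,v\,w\to v(\mathsf{rec}\,(w\langle t,t'\rangle)\,u\,v\,w)$ if $v,w$ are closed. The relation $=_{\mathcal L_{rec}}$ is convertibility, the equivalence relation generated by $\to$ on the terms of $\mathcal L_{rec}$. Values are $0$, $\mathsf S t$, $\lambda x.t$, $\langle s,t\rangle$. Call-by-name evaluation $t\Downarrow_{\mathcal L}V$ of closed terms is defined by: - $V\Downarrow_{\mathcal L}V$ if $V$ is a value; - $st\Downarrow_{\mathcal L}V$ if $s\Downarrow_{\mathcal L}\lambda x.u$ and $u[t/x]\Downarrow_{\mathcal L}V$; - $\mathsf{let}\;t=\langle x,y\rangle\;\mathsf{in}\;u\Downarrow_{\mathcal L}V$ if $t\Downarrow_{\mathcal L}\langle t_1,t_2\rangle$ and $(\lambda xy.u)t_1t_2\Downarrow_{\mathcal L}V$; - $\mathsf{rec}\,t\,u\,v\,w\Downarrow_{\mathcal L}V$ if $t\Downarrow_{\mathcal L}\langle t_1,t_2\rangle$, $t_1\Downarrow_{\mathcal L}0$ and $u\Downarrow_{\mathcal L}V$; - $\mathsf{rec}\,t\,u\,v\,w\Downarrow_{\mathcal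 L}V$ if $t\Downarrow_{\mathcal L}\langle t_1,t_2\rangle$, $t_1\Downarrow_{\mathcal L}\mathsf S t'$ and $v(\mathsf{rec}\,(w\langle t',t_2\rangle)\,u\,v\,w)\Downarrow_{\mathcal L}V$. Put $I=\lambda x.x$, $\mathsf{fst}=\lambda x.\mathsf{let}\;x=\langle a,b\rangle\;\mathsf{in}\;\mathsf{rec}\,\langle b,0\rangle\,a\,I\,I$ and $\mathsf{snd}=\lambda x.\mathsf{let}\;x=\langle a,b\rangle\;\mathsf{in}\;\mathsf{rec}\,\langle a,0\rangle\,b\,I\,I$. By mutual recursion on types, $\mathcal E(t,\mathsf{nat})=\mathsf{rec}\,\langle t,0\rangle\,I\,I\,I$, $\mathcal E(t,A\otimes B)=\mathsf{let}\;t=\langle x,y\rangle\;\mathsf{in}\;\mathcal E(x,A)\,\mathcal E(y,B)$, $\mathcal E(t,A\multimap B)=\mathcal E(t\,\mathcal M(A),B)$, and $\mathcal M(\mathsf{nat})=0$, $\mathcal M(A\otimes B)=\langle\mathcal M(A),\mathcal M(B)\rangle$, $\mathcal M(A\multimap B)=\lambda x.\mathcal E(x,A)\,\mathcal M(B)$.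 The duplicator is $$D^A=\lambda x.\mathsf{rec}\,\langle \mathsf S(\mathsf S0),0\rangle\,\langle\mathcal M(A),\mathcal M(A)\rangle\,(\lambda y.\mathsf{let}\;y=\langle z,w\rangle\;\mathsf{in}\;\mathcal E(z,A)\langle w,x\rangle)\,I .$$ **PCF.** The simply typed $\lambda$-calculus over the base type $\mathsf{nat}$ with constants $n:\mathsf{nat}$ ($n\in\mathbb N$), $\mathsf{succ},\mathsf{pred},\mathsf{iszero}:\mathsf{nat}\to\mathsf{nat}$, $\mathsf{cond}_A:\mathsf{nat}\to A\to A\to A$ and $Y_A:(A\to A)\to A$ for each type $A$. Values are numbers, abstractions, constants, and partially applied conditionals $\mathsf{cond}_A\,t$, $\mathsf{cond}_A\,t\,u$. Call-by-name evaluation $t\Downarrow V$ of closed typed terms is defined by: - $V\Downarrow V$ if $V$ is a value; - $st\Downarrow V$ if $s$ is not a value, $s\Downarrow V'$ and $V't\Downarrow V$; - $(\lambda x.u)t\Downarrow V$ if $u[t/x]\Downarrow V$; - $\mathsf{pred}\,t\Downarrow0$ if $t\Downarrow0$, and $\mathsf{pred}\,t\Downarrow n$ if $t\Downarrow n+1$;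 - $\mathsf{succ}\,t\Downarrow n+1$ if $t\Downarrow n$; - $\mathsf{iszero}\,t\Downarrow0$ if $t\Downarrow0$, and $\mathsf{iszero}\,t\Downarrow1$ if $t\Downarrow n+1$; - $\mathsf{cond}_A\,t\,u\,v\Downarrow V$ if $t\Downarrow0$ and $u\Downarrow V$, or if $t\Downarrow n+1$ and $v\Downarrow V$; - $Y_Af\Downarrow V$ if $f(Y_Af)\Downarrow V$. **Compilation.** On types, $[\![\mathsf{nat}]\!]=\mathsf{nat}$ and $[\![A\to B]\!]=[\![A]\!]\multimap[\![B]\!]$. On terms: - $[\![n]\!]=\mathsf S^n0$, $[\![x]\!]=x$, $[\![uv]\!]=[\![u]\!][\![v]\!]$; - $[\![\mathsf{succ}]\!]=\lambda n.\mathsf{rec}\,\langle n,0\rangle\,(\mathsf S0)\,(\lambda x.\mathsf Sx)\,I$; - $[\![\mathsf{pred}]\!]=\lambda n.\mathsf{fst}(\mathsf{rec}\,\langle n,0\rangle\,\langle0,0\rangle\,(\lambda x.\mathsf{let}\;D^{\mathsf{nat}}(\mathsf{snd}\,x)=\langle t,u\rangle\;\mathsf{in}\;\langle t,\mathsf Su\rangle)\,I)$;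 - $[\![\mathsf{iszero}]\!]=\lambda n.\mathsf{fst}(\mathsf{rec}\,\langle n,0\rangle\,\langle0,\mathsf S0\rangle\,(\lambda x.D^{\mathsf{nat}}(\mathsf{snd}\,x))\,I)$; - $[\![Y_A]\!]=\lambda f.\mathsf{rec}\,\langle\mathsf S0,0\rangle\,\mathcal M([\![A]\!])\,f\,(\lambda x.\mathsf{let}\;x=\langle y,z\rangle\;\mathsf{in}\;\langle\mathsf Sy,z\rangle)$; - $[\![\mathsf{cond}_A]\!]=\lambda tuv.\mathsf{rec}\,\langle t,0\rangle\,u\,(\lambda x.(\mathsf{rec}\,\langle0,0\rangle\,I\,\mathcal E(x,[\![A]\!])\,I)\,v)\,I$; - for $t:B$, $[\![\lambda x^A.t]\!]=\lambda x.[x^{[\![A]\!]}][\![t]\!]$ if $x\in\mathrm{fv}(t)$, and $[\![\lambda x^A.t]\!]=\lambda x.\bigl(\mathsf{rec}\,\langle0,0\rangle\,I\,(\lambda y.\mathcal E(\mathcal E(y,[\![B]\!]\multimap[\![B]\!])\,x,[\![A]\!]))\,I\bigr)[\![t]\!]$ otherwise. Here, for $x$ free in $t$, $[x^A]t$ is defined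 by $[x](\mathsf Su)=\mathsf S([x]u)$, $[x]x=x$, $[x](\lambda y.u)=\lambda y.[x]u$; $[x](su)=([x]s)u$ if $x\notin\mathrm{fv}(u)$, $[x](su)=s([x]u)$ if $x\notin\mathrm{fv}(s)$, and $$[x^A](su)=\mathsf{let}\;D^Ax=\langle x_1,x_2\rangle\;\mathsf{in}\;\bigl(([x]s)[x_1/x]\bigr)\bigl(([x]u)[x_2/x]\bigr)\quad(x_1,x_2\text{ fresh})$$ if $x\in\mathrm{fv}(s)\cap\mathrm{fv}(u)$; on the $\mathsf{let}$-terms so introduced for other variables, $[x](\mathsf{let}\;s=\langle y_1,y_2\rangle\;\mathsf{in}\;u)=\mathsf{let}\;s=\langle y_1,y_2\rangle\;\mathsf{in}\;[x]u$. **Theorem.** Let $t$ be a closed (typed) PCF term. If $t\Downarrow V$, then there is $V'$ such that $[\![t]\!]\Downarrow_{\mathcal L}V'$ and $V'=_{\mathcal L_{rec}}[\![V]\!]$. -/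

import Mathlib

/-! ## The calculus `L_rec`

A linear lambda-calculus with numbers, pairs and an unbounded recursor. Terms are taken
modulo alpha-equivalence, by means of de Bruijn indices. -/

namespace Lrec

/-- Linear types: numbers, linear functions and tensor products. -/
inductive Ty : Type
  | nat : Ty
  | lolli : Ty → Ty → Ty
  | tensor : Ty → Ty → Ty

/-- Raw terms. `letp t u` is `let t = ⟨x, y⟩ in u`; it binds two variables in `u`: the second
component `y` is the index `0` and the first component `x` is the index `1`. -/
inductive Tm : Type
  | var : ℕ → Tm
  | zero : Tm
  | suc : Tm → Tm
  | recur : Tm → Tm → Tm → Tm → Tm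
  | app : Tm → Tm → Tm
  | lam : Tm → Tm
  | pair : Tm → Tm → Tm
  | letp : Tm → Tm → Tm

namespace Tm

/-- `occurs i t`: the variable with index `i` is one of the free variables of `t`. -/
def occurs : ℕ → Tm → Bool
  | i, var j => i == j
  | _, zero => false
  | i, suc t => occurs i t
  | i, recur t u v w => occurs i t || occurs i u || occurs i v || occurs i w
  | i, app t u => occurs i t || occurs i u
  | i, lam t => occurs (i + 1) t
  | i, pair t u => occurs i t || occurs i u
  | i, letp t u => occurs i t || occurs (i + 2) u

/-- The term has no free variable. -/
def Closed (t : Tm) : Prop := ∀ i, t.occurs i = false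

/-- The terms have no free variable in common. -/
def FVDisjoint (t u : Tm) : Prop := ∀ i, ¬ (t.occurs i = true ∧ u.occurs i = true)

/-- The variable constraints that single out the terms of `L_rec` among the raw terms: every
variable, free or bound, is used exactly once. -/
def Linear : Tm → Prop
  | var _ => True
  | zero => True
  | suc t => Linear t
  | recur t u v w =>
      (Linear t ∧ Linear u ∧ Linear v ∧ Linear w) ∧
      FVDisjoint t u ∧ FVDisjoint t v ∧ FVDisjoint t w ∧
      FVDisjoint u v ∧ FVDisjoint u w ∧ FVDisjoint v w
  | app t u => Linear t ∧ Linear u ∧ FVDisjoint t u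
  | lam t => Linear t ∧ t.occurs 0 = true
  | pair t u => Linear t ∧ Linear u ∧ FVDisjoint t u
  | letp t u =>
      Linear t ∧ Linear u ∧ u.occurs 0 = true ∧ u.occurs 1 = true ∧
      ∀ i, ¬ (t.occurs i = true ∧ u.occurs (i + 2) = true)

/-- Lifting of a renaming under a binder. -/
def liftRen (ρ : ℕ → ℕ) : ℕ → ℕ
  | 0 => 0
  | n + 1 => ρ n + 1

/-- Renaming of free variables. -/
def rename : (ℕ → ℕ) → Tm → Tm
  | ρ, var i => var (ρ i)
  | _, zero => zero
  | ρ, suc t => suc (rename ρ t)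
  | ρ, recur t u v w => recur (rename ρ t) (rename ρ u) (rename ρ v) (rename ρ w)
  | ρ, app t u => app (rename ρ t) (rename ρ u)
  | ρ, lam t => lam (rename (liftRen ρ) t)
  | ρ, pair t u => pair (rename ρ t) (rename ρ u)
  | ρ, letp t u => letp (rename ρ t) (rename (liftRen (liftRen ρ)) u)

/-- Lifting of a substitution under a binder. -/
def liftSub (σ : ℕ → Tm) : ℕ → Tm
  | 0 => var 0
  | n + 1 => rename Nat.succ (σ n)

/-- Simultaneous capture-avoiding substitution. -/
def subst : (ℕ → Tm) → Tm → Tm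
  | σ, var i => σ i
  | _, zero => zero
  | σ, suc t => suc (subst σ t)
  | σ, recur t u v w => recur (subst σ t) (subst σ u) (subst σ v) (subst σ w)
  | σ, app t u => app (subst σ t) (subst σ u)
  | σ, lam t => lam (subst (liftSub σ) t)
  | σ, pair t u => pair (subst σ t) (subst σ u)
  | σ, letp t u => letp (subst σ t) (subst (liftSub (liftSub σ)) u)

/-- `consSub v σ` maps the index `0` to `v` and `n + 1` to `σ n`. -/
def consSub (v : Tm) (σ : ℕ → Tm) : ℕ → Tm
  | 0 => v
  | n + 1 => σ n

/-- `t[v/x]`, where `x` is the variable with index `0`. -/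
def inst (t v : Tm) : Tm := subst (consSub v var) t

/-- `v[t/x][u/y]`, where `x` has index `1` and `y` has index `0`. -/
def inst₂ (v t u : Tm) : Tm := subst (consSub u (consSub t var)) v

end Tm

open Tm in
/-- One step of closed reduction, in an arbitrary context. -/
inductive Step : Tm → Tm → Prop
  | beta {t v : Tm} : v.Closed → Step (app (lam t) v) (inst t v)
  | letPair {t u v : Tm} : t.Closed → u.Closed → Step (letp (pair t u) v) (inst₂ v t u)
  | recZero {t' u v w : Tm} : t'.Closed → v.Closed → w.Closed →
      Step (recur (pair zero t') u v w) u
  | recSuc {t t' u v w : Tm} : v.Closed → w.Closed →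
      Step (recur (pair (suc t) t') u v w) (app v (recur (app w (pair t t')) u v w))
  | suc {t t' : Tm} : Step t t' → Step (suc t) (suc t')
  | rec₁ {t t' u v w : Tm} : Step t t' → Step (recur t u v w) (recur t' u v w)
  | rec₂ {t u u' v w : Tm} : Step u u' → Step (recur t u v w) (recur t u' v w)
  | rec₃ {t u v v' w : Tm} : Step v v' → Step (recur t u v w) (recur t u v' w)
  | rec₄ {t u v w w' : Tm} : Step w w' → Step (recur t u v w) (recur t u v w')
  | app₁ {t t' u : Tm} : Step t t' → Step (app t u) (app t' u)
  | app₂ {t u u' : Tm} : Step u u' → Step (app t u) (app t u')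
  | lam {t t' : Tm} : Step t t' → Step (lam t) (lam t')
  | pair₁ {t t' u : Tm} : Step t t' → Step (pair t u) (pair t' u)
  | pair₂ {t u u' : Tm} : Step u u' → Step (pair t u) (pair t u')
  | let₁ {t t' u : Tm} : Step t t' → Step (letp t u) (letp t' u)
  | let₂ {t u u' : Tm} : Step u u' → Step (letp t u) (letp t u')

/-- The equality of `L_rec`: convertibility, that is, the equivalence relation generated by
reduction on the terms of `L_rec` (which are linear by definition). -/
def Conv (t u : Tm) : Prop :=
  t.Linear ∧ u.Linear ∧
    Relation.EqvGen (fun a b : Tm => a.Linear ∧ b.Linear ∧ Step a b) t u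

/-- Values (weak head normal forms): `0`, `S t`, `λ x. t` and `⟨s, t⟩`. -/
inductive IsValue : Tm → Prop
  | zero : IsValue Tm.zero
  | suc (t : Tm) : IsValue (Tm.suc t)
  | lam (t : Tm) : IsValue (Tm.lam t)
  | pair (s t : Tm) : IsValue (Tm.pair s t)

open Tm in
/-- The rules of call-by-name evaluation. -/
inductive BigStep : Tm → Tm → Prop
  | val {V : Tm} : IsValue V → BigStep V V
  | app {s t u V : Tm} : BigStep s (lam u) → BigStep (inst u t) V → BigStep (app s t) V
  | letp {t t₁ t₂ u V : Tm} : BigStep t (pair t₁ t₂) →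
      BigStep (app (app (lam (lam u)) t₁) t₂) V → BigStep (letp t u) V
  | rec₁ {t t₁ t₂ u v w V : Tm} : BigStep t (pair t₁ t₂) → BigStep t₁ zero →
      BigStep u V → BigStep (recur t u v w) V
  | rec₂ {t t₁ t₂ t' u v w V : Tm} : BigStep t (pair t₁ t₂) → BigStep t₁ (suc t') →
      BigStep (app v (recur (app w (pair t' t₂)) u v w)) V → BigStep (recur t u v w) V

/-- `t ⇓_L V`: the closed term `t` of `L_rec` evaluates to `V` under call-by-name. -/
def Eval (t V : Tm) : Prop := t.Linear ∧ t.Closed ∧ BigStep t V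

namespace Tm

/-- The identity function. -/
def I : Tm := lam (var 0)

/-- The numeral `S^n 0`. -/
def num : ℕ → Tm
  | 0 => zero
  | n + 1 => suc (num n)

mutual
/-- `erase t A` is the term `E(t, A)`, which consumes `t : A` and becomes the identity. -/
def erase (t : Tm) : Ty → Tm
  | .nat => recur (pair t zero) I I I
  | .tensor A B => letp t (app (erase (var 1) A) (erase (var 0) B))
  | .lolli A B => erase (app t (make A)) B
/-- `make A` is the term `M(A)`, a closed term of type `A`. -/
def make : Ty → Tm
  | .nat => zero
  | .tensor A B => pair (make A) (make B)
  | .lolli A B => lam (app (erase (var 0) A) (make B))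
end

/-- The duplicator `D^A = λ x. rec ⟨S (S 0), 0⟩ ⟨M(A), M(A)⟩ F I`, where
`F = λ y. let y = ⟨z, w⟩ in E(z, A) ⟨w, x⟩`. -/
def dup (A : Ty) : Tm :=
  lam (recur (pair (suc (suc zero)) zero) (pair (make A) (make A))
    (lam (letp (var 0) (app (erase (var 1) A) (pair (var 0) (var 3))))) I)

/-- `fst = λ x. let x = ⟨a, b⟩ in rec ⟨b, 0⟩ a I I`. -/
def fst : Tm := lam (letp (var 0) (recur (pair (var 0) zero) (var 1) I I))

/-- `snd = λ x. let x = ⟨a, b⟩ in rec ⟨a, 0⟩ b I I`. -/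
def snd : Tm := lam (letp (var 0) (recur (pair (var 1) zero) (var 0) I I))

/-- `linearize A i t` is `[x^A] t`, where `x` is the variable with index `i`, free in `t`: the
several occurrences of `x` in `t` are replaced by copies made by the duplicator.
In an application `s u` both parts of which contain `x` the result is
`let D^A x = ⟨x₁, x₂⟩ in (([x] s)[x₁/x]) (([x] u)[x₂/x])` with `x₁`, `x₂` fresh.
A `let` that is met on the way was made by the same operation for another variable, so that
`x` is in its body; pairs and recursors that are met do not contain `x`. -/
def linearize (A : Ty) : ℕ → Tm → Tm
  | i, suc u => suc (linearize A i u)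
  | _, var j => var j
  | i, lam u => lam (linearize A (i + 1) u)
  | i, app s u =>
      if s.occurs i && u.occurs i then
        letp (app (dup A) (var i))
          (app (rename (fun j => if j = i then 1 else j + 2) (linearize A i s))
            (rename (fun j => if j = i then 0 else j + 2) (linearize A i u)))
      else if s.occurs i then app (linearize A i s) u
      else app s (linearize A i u)
  | i, letp s u => letp s (linearize A (i + 2) u)
  | _, zero => zero
  | _, pair t u => pair t u
  | _, recur t u v w => recur t u v w

end Tm

end Lrec

/-! ## PCF

The typed terms of PCF are given as an intrinsically typed syntax with de Bruijn indices. -/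

namespace PCF

/-- Types of PCF. -/
inductive Ty : Type
  | nat : Ty
  | arr : Ty → Ty → Ty

/-- Type environments; the most recently bound variable comes first. -/
abbrev Ctx : Type := List Ty

/-- `Var Γ A`: the variables of type `A` in the environment `Γ`. -/
inductive Var : Ctx → Ty → Type
  | zero {Γ : Ctx} {A : Ty} : Var (A :: Γ) A
  | succ {Γ : Ctx} {A B : Ty} : Var Γ A → Var (B :: Γ) A

/-- The de Bruijn index of a variable. -/
def Var.toNat {Γ : Ctx} {A : Ty} : Var Γ A → ℕ
  | .zero => 0
  | .succ x => x.toNat + 1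

/-- `Tm Γ A`: the terms of type `A` in the environment `Γ`. -/
inductive Tm : Ctx → Ty → Type
  | var {Γ : Ctx} {A : Ty} : Var Γ A → Tm Γ A
  | lam {Γ : Ctx} {A B : Ty} : Tm (A :: Γ) B → Tm Γ (Ty.arr A B)
  | app {Γ : Ctx} {A B : Ty} : Tm Γ (Ty.arr A B) → Tm Γ A → Tm Γ B
  | num {Γ : Ctx} : ℕ → Tm Γ Ty.nat
  | succ {Γ : Ctx} : Tm Γ (Ty.arr Ty.nat Ty.nat)
  | pred {Γ : Ctx} : Tm Γ (Ty.arr Ty.nat Ty.nat)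
  | iszero {Γ : Ctx} : Tm Γ (Ty.arr Ty.nat Ty.nat)
  | cond {Γ : Ctx} (A : Ty) : Tm Γ (Ty.arr Ty.nat (Ty.arr A (Ty.arr A A)))
  | fix {Γ : Ctx} (A : Ty) : Tm Γ (Ty.arr (Ty.arr A A) A)

namespace Tm

/-- `t.occurs i`: the variable with index `i` is one of the free variables of `t`. -/
def occurs : {Γ : Ctx} → {A : Ty} → ℕ → Tm Γ A → Bool
  | _, _, i, var x => i == x.toNat
  | _, _, i, lam t => occurs (i + 1) t
  | _, _, i, app t u => occurs i t || occurs i u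
  | _, _, _, num _ => false
  | _, _, _, succ => false
  | _, _, _, pred => false
  | _, _, _, iszero => false
  | _, _, _, cond _ => false
  | _, _, _, fix _ => false

/-- Lifting of a renaming under a binder. -/
def liftRen {Γ Δ : Ctx} (ρ : ∀ A : Ty, Var Γ A → Var Δ A) (B : Ty) :
    ∀ A : Ty, Var (B :: Γ) A → Var (B :: Δ) A
  | _, .zero => .zero
  | _, .succ x => .succ (ρ _ x)

/-- Renaming of variables. -/
def rename : {Γ Δ : Ctx} → {A : Ty} → (∀ A : Ty, Var Γ A → Var Δ A) → Tm Γ A → Tm Δ A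
  | _, _, _, ρ, var x => var (ρ _ x)
  | _, _, _, ρ, lam t => lam (rename (liftRen ρ _) t)
  | _, _, _, ρ, app t u => app (rename ρ t) (rename ρ u)
  | _, _, _, _, num n => num n
  | _, _, _, _, succ => succ
  | _, _, _, _, pred => pred
  | _, _, _, _, iszero => iszero
  | _, _, _, _, cond A => cond A
  | _, _, _, _, fix A => fix A

/-- Lifting of a substitution under a binder. -/
def liftSub {Γ Δ : Ctx} (σ : ∀ A : Ty, Var Γ A → Tm Δ A) (B : Ty) :
    ∀ A : Ty, Var (B :: Γ) A → Tm (B :: Δ) A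
  | _, .zero => var .zero
  | _, .succ x => rename (fun _ y => .succ y) (σ _ x)

/-- Simultaneous capture-avoiding substitution. -/
def subst : {Γ Δ : Ctx} → {A : Ty} → (∀ A : Ty, Var Γ A → Tm Δ A) → Tm Γ A → Tm Δ A
  | _, _, _, σ, var x => σ _ x
  | _, _, _, σ, lam t => lam (subst (liftSub σ _) t)
  | _, _, _, σ, app t u => app (subst σ t) (subst σ u)
  | _, _, _, _, num n => num n
  | _, _, _, _, succ => succ
  | _, _, _, _, pred => pred
  | _, _, _, _, iszero => iszero
  | _, _, _, _, cond A => cond A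
  | _, _, _, _, fix A => fix A

/-- The substitution that replaces the last variable by `t` and keeps the others. -/
def single {Γ : Ctx} {B : Ty} (t : Tm Γ B) : ∀ A : Ty, Var (B :: Γ) A → Tm Γ A
  | _, .zero => t
  | _, .succ x => var x

/-- `u[t/x]`, where `x` is the last variable of the environment of `u`. -/
def inst {Γ : Ctx} {A B : Ty} (u : Tm (B :: Γ) A) (t : Tm Γ B) : Tm Γ A :=
  subst (single t) u

end Tm

open Tm in
/-- Values: numbers, abstractions, constants and partially applied conditionals. -/
inductive IsValue : {A : Ty} → Tm [] A → Prop
  | num (n : ℕ) : IsValue (num n)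
  | lam {A B : Ty} (t : Tm [A] B) : IsValue (lam t)
  | succ : IsValue succ
  | pred : IsValue pred
  | iszero : IsValue iszero
  | cond (A : Ty) : IsValue (cond A)
  | fix (A : Ty) : IsValue (fix A)
  | cond₁ {A : Ty} (t : Tm [] Ty.nat) : IsValue (app (cond A) t)
  | cond₂ {A : Ty} (t : Tm [] Ty.nat) (u : Tm [] A) : IsValue (app (app (cond A) t) u)

open Tm in
/-- `Eval t V` is `t ⇓ V`: the closed term `t` evaluates to `V` under call-by-name. -/
inductive Eval : {A : Ty} → Tm [] A → Tm [] A → Prop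
  | val {A : Ty} {V : Tm [] A} : IsValue V → Eval V V
  | app {A B : Ty} {s V' : Tm [] (Ty.arr A B)} {t : Tm [] A} {V : Tm [] B} :
      Eval s V' → Eval (app V' t) V → ¬ IsValue s → Eval (app s t) V
  | beta {A B : Ty} {u : Tm [A] B} {t : Tm [] A} {V : Tm [] B} :
      Eval (inst u t) V → Eval (app (lam u) t) V
  | predZero {t : Tm [] Ty.nat} : Eval t (num 0) → Eval (app pred t) (num 0)
  | predSucc {t : Tm [] Ty.nat} {n : ℕ} : Eval t (num (n + 1)) → Eval (app pred t) (num n)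
  | succ {t : Tm [] Ty.nat} {n : ℕ} : Eval t (num n) → Eval (app succ t) (num (n + 1))
  | iszeroZero {t : Tm [] Ty.nat} : Eval t (num 0) → Eval (app iszero t) (num 0)
  | iszeroSucc {t : Tm [] Ty.nat} {n : ℕ} :
      Eval t (num (n + 1)) → Eval (app iszero t) (num 1)
  | condZero {A : Ty} {t : Tm [] Ty.nat} {u v V : Tm [] A} :
      Eval t (num 0) → Eval u V → Eval (app (app (app (cond A) t) u) v) V
  | condSucc {A : Ty} {t : Tm [] Ty.nat} {n : ℕ} {u v V : Tm [] A} :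
      Eval t (num (n + 1)) → Eval v V → Eval (app (app (app (cond A) t) u) v) V
  | fix {A : Ty} {f : Tm [] (Ty.arr A A)} {V : Tm [] A} :
      Eval (app f (app (fix A) f)) V → Eval (app (fix A) f) V

/-! ## The compilation of PCF into `L_rec` -/

/-- The translation of types. -/
def Ty.compile : Ty → Lrec.Ty
  | .nat => .nat
  | .arr A B => .lolli A.compile B.compile

open Lrec.Tm in
/-- `⟦succ⟧ = λ n. rec ⟨n, 0⟩ (S 0) (λ x. S x) I`. -/
def compileSucc : Lrec.Tm :=
  lam (recur (pair (var 0) zero) (suc zero) (lam (suc (var 0))) I)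

open Lrec.Tm in
/-- `⟦pred⟧ = λ n. fst (rec ⟨n, 0⟩ ⟨0, 0⟩
(λ x. let D^nat (snd x) = ⟨t, u⟩ in ⟨t, S u⟩) I)`. -/
def compilePred : Lrec.Tm :=
  lam (app fst (recur (pair (var 0) zero) (pair zero zero)
    (lam (letp (app (dup .nat) (app snd (var 0))) (pair (var 1) (suc (var 0))))) I))

open Lrec.Tm in
/-- `⟦iszero⟧ = λ n. fst (rec ⟨n, 0⟩ ⟨0, S 0⟩ (λ x. D^nat (snd x)) I)`. -/
def compileIszero : Lrec.Tm :=
  lam (app fst (recur (pair (var 0) zero) (pair zero (suc zero))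
    (lam (app (dup .nat) (app snd (var 0)))) I))

open Lrec.Tm in
/-- `⟦Y_A⟧ = λ f. rec ⟨S 0, 0⟩ M(A) f (λ x. let x = ⟨y, z⟩ in ⟨S y, z⟩)`. -/
def compileFix (A : Lrec.Ty) : Lrec.Tm :=
  lam (recur (pair (suc zero) zero) (make A) (var 0)
    (lam (letp (var 0) (pair (suc (var 1)) (var 0)))))

open Lrec.Tm in
/-- `⟦cond_A⟧ = λ t u v. rec ⟨t, 0⟩ u (λ x. (rec ⟨0, 0⟩ I E(x, A) I) v) I`. -/
def compileCond (A : Lrec.Ty) : Lrec.Tm :=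
  lam (lam (lam (recur (pair (var 2) zero) (var 1)
    (lam (app (recur (pair zero zero) I (erase (var 0) A) I) (var 1))) I)))

/-- The compilation `⟦t⟧` of a PCF term. An abstraction `λ x^A. t`, with `t : B`, becomes
`λ x. [x^A] ⟦t⟧` if `x` is free in `t`, and otherwise
`λ x. (rec ⟨0, 0⟩ I (λ y. E(E(y, B ⊸ B) x, A)) I) ⟦t⟧`. -/
def Tm.compile : {Γ : Ctx} → {A : Ty} → Tm Γ A → Lrec.Tm
  | _, _, .var x => Lrec.Tm.var x.toNat
  | _, _, @Tm.lam _ A B t =>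
      if t.occurs 0 then .lam (Lrec.Tm.linearize A.compile 0 t.compile)
      else
        .lam (.app
          (.recur (.pair .zero .zero) Lrec.Tm.I
            (.lam (Lrec.Tm.erase
              (.app (Lrec.Tm.erase (.var 0) (.lolli B.compile B.compile)) (.var 1))
              A.compile))
            Lrec.Tm.I)
          t.compile)
  | _, _, .app t u => .app t.compile u.compile
  | _, _, .num n => Lrec.Tm.num n
  | _, _, .succ => compileSucc
  | _, _, .pred => compilePred
  | _, _, .iszero => compileIszero
  | _, _, .cond A => compileCond A.compile
  | _, _, .fix A => compileFix A.compile

end PCF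

/-!
Two facts are combined.

*Soundness for convertibility* (`PCF.Eval.conv_compile`): if `t ⇓ V` in PCF, then `⟦t⟧` and `⟦V⟧`
are convertible in `L_rec`. This goes by induction on evaluation. The constants are computed by
reduction inside `L_rec`. For beta, compilation commutes with substitution on the nose
(`PCF.Tm.compile_subst`), and substituting a closed term for a linearized variable reduces to
substituting it for all occurrences of the variable (`Lrec.red_subst_linearize`), because the
duplicator `D^A` really duplicates closed terms (`Lrec.red_dup_app`). No typing is needed: the only
terms that `D^A` erases are the canonical inhabitants `M(A)`, and `E(M(A), A)` reduces to the
identity for every `A` (`Lrec.red_erase_make`). Convertibility lives on linear terms; that compiled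
terms are linear follows from an invariant which permits the free variables, but no others, to be
repeated (`Lrec.Tm.LinearOff`, `PCF.Tm.linearOff_compile`), and reduction preserves linearity.

*Invariance of evaluation under convertibility* (`Lrec.Conv.exists_wHeads`): a linear term that is
convertible to a term with a weak head normal form has a convertible weak head normal form.
Confluence is not needed for this. Standard reduction `Lrec.Std` (weak head reduction to the
outermost constructor of the target, then the same inside) contains reduction of linear terms
(`Lrec.Std.step`), so that weak head normal forms can be pulled back along a step of reduction; and
since weak head reduction is deterministic, standard reducts follow the weak head reductions of
their source (`Lrec.Std.exists_wHeads`), so that weak head normal forms can be pushed forward.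

Since `⟦V⟧` has a weak head normal form (`PCF.IsValue.exists_wHeads`), so has `⟦t⟧`, and weak head
reduction of a term to a value gives its call-by-name evaluation (`Lrec.WHeads.bigStep`).
-/

/-! ### Substitution -/

namespace Lrec

namespace Tm

theorem liftSub_var_comp (ρ : ℕ → ℕ) :
    liftSub (fun i => var (ρ i)) = fun i => var (liftRen ρ i) := by
  funext i; cases i <;> rfl

theorem rename_eq_subst (ρ : ℕ → ℕ) (t : Tm) : rename ρ t = subst (fun i => var (ρ i)) t := by
  induction t generalizing ρ <;> simp_all [rename, subst, liftSub_var_comp]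

theorem liftSub_comp_liftRen (σ : ℕ → Tm) (ρ : ℕ → ℕ) :
    (fun i => liftSub σ (liftRen ρ i)) = liftSub fun i => σ (ρ i) := by
  funext i; cases i <;> rfl

theorem subst_rename (σ : ℕ → Tm) (ρ : ℕ → ℕ) (t : Tm) :
    subst σ (rename ρ t) = subst (fun i => σ (ρ i)) t := by
  induction t generalizing σ ρ <;> simp_all [rename, subst, liftSub_comp_liftRen]

theorem rename_liftSub (σ : ℕ → Tm) (ρ : ℕ → ℕ) :
    (fun i => rename (liftRen ρ) (liftSub σ i)) = liftSub fun i => rename ρ (σ i) := by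
  funext i
  cases i
  · rfl
  · simp [liftSub, rename_eq_subst (liftRen ρ), rename_eq_subst ρ, subst_rename, liftRen]
    rw [← rename_eq_subst fun i => ρ i + 1, rename_eq_subst Nat.succ,
      ← rename_eq_subst ρ, ← rename_eq_subst Nat.succ]
    rw [rename_eq_subst Nat.succ, subst_rename, rename_eq_subst]

theorem rename_subst (ρ : ℕ → ℕ) (σ : ℕ → Tm) (t : Tm) :
    rename ρ (subst σ t) = subst (fun i => rename ρ (σ i)) t := by
  induction t generalizing σ ρ <;> simp_all [rename, subst, rename_liftSub]

theorem subst_liftSub (σ τ : ℕ → Tm) :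
    (fun i => subst (liftSub τ) (liftSub σ i)) = liftSub fun i => subst τ (σ i) := by
  funext i
  cases i
  · rfl
  · simp [liftSub, subst_rename, rename_subst]

theorem subst_subst (σ τ : ℕ → Tm) (t : Tm) :
    subst τ (subst σ t) = subst (fun i => subst τ (σ i)) t := by
  induction t generalizing σ τ <;> simp_all [subst, subst_liftSub]

theorem liftSub_var : liftSub var = var := by
  funext i; cases i <;> rfl

theorem subst_var (t : Tm) : subst var t = t := by
  induction t <;> simp_all [subst, liftSub_var]

theorem subst_inst (σ : ℕ → Tm) (t v : Tm) :
    subst σ (inst t v) = inst (subst (liftSub σ) t) (subst σ v) := by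
  simp only [inst, subst_subst]
  congr 1; funext i
  cases i
  · rfl
  · simp [consSub, liftSub, subst_rename, subst, subst_var]

theorem subst_inst₂ (σ : ℕ → Tm) (v t u : Tm) :
    subst σ (inst₂ v t u) =
      inst₂ (subst (liftSub (liftSub σ)) v) (subst σ t) (subst σ u) := by
  simp only [inst₂, subst_subst]
  congr 1; funext i
  rcases i with _ | _ | i
  · rfl
  · rfl
  · simp [consSub, liftSub, subst_rename, subst, subst_var]

/-- Two successive contractions in `(λ x y. v) t u` give `v[t/x][u/y]`. -/
theorem inst_subst_liftSub (v t u : Tm) :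
    inst (subst (liftSub (consSub t var)) v) u = inst₂ v t u := by
  simp only [inst₂, inst, subst_subst]
  congr 1; funext i
  rcases i with _ | _ | i
  · rfl
  · simp [consSub, liftSub, subst_rename, subst_var]
  · rfl

/-! ### Free variables and linearity under substitution -/

theorem occurs_rename (ρ : ℕ → ℕ) (t : Tm) (i : ℕ) :
    occurs i (rename ρ t) = true ↔ ∃ j, occurs j t = true ∧ i = ρ j := by
  have lift : ∀ (ρ : ℕ → ℕ) (P : ℕ → Prop) (i : ℕ),
      (∃ j, P j ∧ i + 1 = liftRen ρ j) ↔ ∃ j, P (j + 1) ∧ i = ρ j := by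
    intro ρ P i
    constructor
    · rintro ⟨_ | j, h, e⟩
      · simp [liftRen] at e
      · exact ⟨j, h, by simpa [liftRen] using e⟩
    · rintro ⟨j, h, e⟩
      exact ⟨j + 1, h, by simp [liftRen, e]⟩
  induction t generalizing ρ i with
  | var j => simp [rename, occurs]
  | zero => simp [rename, occurs]
  | suc t iht => simp [rename, occurs, iht]
  | recur t u v w iht ihu ihv ihw =>
    simp [rename, occurs, iht, ihu, ihv, ihw, or_and_right, exists_or]
  | app t u iht ihu => simp [rename, occurs, iht, ihu, or_and_right, exists_or]
  | lam t iht => simp only [rename, occurs, iht, lift]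
  | pair t u iht ihu => simp [rename, occurs, iht, ihu, or_and_right, exists_or]
  | letp t u iht ihu =>
    simp only [rename, occurs, iht, ihu, Bool.or_eq_true, or_and_right, exists_or]
    rw [show i + 2 = i + 1 + 1 from rfl, lift, lift]

theorem occurs_succ_rename_succ (t : Tm) (i : ℕ) :
    occurs (i + 1) (rename Nat.succ t) = occurs i t := by
  rw [Bool.eq_iff_iff, occurs_rename]
  simp

theorem occurs_zero_rename_succ (t : Tm) : occurs 0 (rename Nat.succ t) = false := by
  rw [Bool.eq_false_iff, Ne, occurs_rename]
  simp

theorem exists_occurs_liftSub (σ : ℕ → Tm) (P : ℕ → Prop) (i : ℕ) :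
    (∃ j, P j ∧ occurs (i + 1) (liftSub σ j) = true) ↔
      ∃ j, P (j + 1) ∧ occurs i (σ j) = true := by
  constructor
  · rintro ⟨_ | j, h, e⟩
    · simp [liftSub, occurs] at e
    · exact ⟨j, h, by simpa [liftSub, occurs_succ_rename_succ] using e⟩
  · rintro ⟨j, h, e⟩
    exact ⟨j + 1, h, by simpa [liftSub, occurs_succ_rename_succ] using e⟩

theorem occurs_subst (σ : ℕ → Tm) (t : Tm) (i : ℕ) :
    occurs i (subst σ t) = true ↔ ∃ j, occurs j t = true ∧ occurs i (σ j) = true := by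
  induction t generalizing σ i with
  | var j => simp [subst, occurs]
  | zero => simp [subst, occurs]
  | suc t iht => simp [subst, occurs, iht]
  | recur t u v w iht ihu ihv ihw =>
    simp [subst, occurs, iht, ihu, ihv, ihw, or_and_right, exists_or]
  | app t u iht ihu => simp [subst, occurs, iht, ihu, or_and_right, exists_or]
  | lam t iht => simp only [subst, occurs, iht, exists_occurs_liftSub]
  | pair t u iht ihu => simp [subst, occurs, iht, ihu, or_and_right, exists_or]
  | letp t u iht ihu =>
    simp only [subst, occurs, iht, ihu, Bool.or_eq_true, or_and_right, exists_or]
    rw [show i + 2 = i + 1 + 1 from rfl, exists_occurs_liftSub, exists_occurs_liftSub]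

theorem occurs_zero_liftSub (σ : ℕ → Tm) (j : ℕ) :
    occurs 0 (liftSub σ j) = true ↔ j = 0 := by
  cases j <;> simp [liftSub, occurs, occurs_zero_rename_succ]

theorem occurs_zero_subst_liftSub (σ : ℕ → Tm) (t : Tm) :
    occurs 0 (subst (liftSub σ) t) = occurs 0 t := by
  rw [Bool.eq_iff_iff, occurs_subst]
  simp [occurs_zero_liftSub]

theorem occurs_one_subst_liftSub_liftSub (σ : ℕ → Tm) (t : Tm) :
    occurs 1 (subst (liftSub (liftSub σ)) t) = occurs 1 t := by
  rw [Bool.eq_iff_iff, occurs_subst, exists_occurs_liftSub (liftSub σ)]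
  simp [occurs_zero_liftSub]

theorem subst_congr {σ τ : ℕ → Tm} {t : Tm} (h : ∀ i, occurs i t = true → σ i = τ i) :
    subst σ t = subst τ t := by
  have lift : ∀ {σ τ : ℕ → Tm} {P : ℕ → Prop}, (∀ i, P (i + 1) → σ i = τ i) →
      ∀ i, P i → liftSub σ i = liftSub τ i := by
    rintro σ τ P h (_ | i) hi
    · rfl
    · simp [liftSub, h i hi]
  induction t generalizing σ τ with
  | var j => exact h j (by simp [occurs])
  | zero => rfl
  | suc t iht => simp [subst, iht h]
  | recur t u v w iht ihu ihv ihw =>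
    simp only [occurs, Bool.or_eq_true] at h
    simp only [subst]
    rw [iht, ihu, ihv, ihw] <;> intro i hi <;> exact h i (by simp [hi])
  | app t u iht ihu =>
    simp only [occurs, Bool.or_eq_true] at h
    simp only [subst]
    rw [iht, ihu] <;> intro i hi <;> exact h i (by simp [hi])
  | lam t iht => simp only [subst]; rw [iht (lift h)]
  | pair t u iht ihu =>
    simp only [occurs, Bool.or_eq_true] at h
    simp only [subst]
    rw [iht, ihu] <;> intro i hi <;> exact h i (by simp [hi])
  | letp t u iht ihu =>
    simp only [occurs, Bool.or_eq_true] at h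
    simp only [subst]
    rw [iht fun i hi => h i (Or.inl hi),
      ihu (lift (P := fun i => occurs i u = true)
        (lift (P := fun i => occurs (i + 1) u = true) fun i hi => h i (Or.inr hi)))]

theorem Closed.subst_eq {t : Tm} (h : t.Closed) (σ : ℕ → Tm) : subst σ t = t := by
  conv_rhs => rw [← subst_var t]
  exact subst_congr fun i hi => by simp [h i] at hi

theorem Closed.rename_eq {t : Tm} (h : t.Closed) (ρ : ℕ → ℕ) : rename ρ t = t := by
  rw [rename_eq_subst, h.subst_eq]

theorem Closed.fvDisjoint_left {t : Tm} (h : t.Closed) (u : Tm) : FVDisjoint t u :=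
  fun i hi => by simp [h i] at hi

theorem Closed.fvDisjoint_right {t : Tm} (h : t.Closed) (u : Tm) : FVDisjoint u t :=
  fun i hi => by simp [h i] at hi

theorem linear_rename {ρ : ℕ → ℕ} (hρ : Function.Injective ρ) {t : Tm} (ht : t.Linear) :
    (rename ρ t).Linear := by
  have lift : ∀ {ρ : ℕ → ℕ}, Function.Injective ρ → Function.Injective (liftRen ρ) := by
    intro ρ hρ i j h
    cases i <;> cases j <;> simp_all [liftRen, hρ.eq_iff]
  have disj : ∀ {ρ : ℕ → ℕ} {t u : Tm}, Function.Injective ρ → FVDisjoint t u →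
      FVDisjoint (rename ρ t) (rename ρ u) := by
    rintro ρ t u hρ h i ⟨h₁, h₂⟩
    obtain ⟨j, hj, rfl⟩ := (occurs_rename _ _ _).1 h₁
    obtain ⟨k, hk, e⟩ := (occurs_rename _ _ _).1 h₂
    exact h j ⟨hj, by rwa [hρ e]⟩
  induction t generalizing ρ with
  | var j => trivial
  | zero => trivial
  | suc t iht => exact iht hρ ht
  | recur t u v w iht ihu ihv ihw =>
    obtain ⟨⟨h₁, h₂, h₃, h₄⟩, d₁, d₂, d₃, d₄, d₅, d₆⟩ := ht
    exact ⟨⟨iht hρ h₁, ihu hρ h₂, ihv hρ h₃, ihw hρ h₄⟩, disj hρ d₁, disj hρ d₂, disj hρ d₃,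
      disj hρ d₄, disj hρ d₅, disj hρ d₆⟩
  | app t u iht ihu => exact ⟨iht hρ ht.1, ihu hρ ht.2.1, disj hρ ht.2.2⟩
  | lam t iht =>
    exact ⟨iht (lift hρ) ht.1, (occurs_rename _ _ _).2 ⟨0, ht.2, rfl⟩⟩
  | pair t u iht ihu => exact ⟨iht hρ ht.1, ihu hρ ht.2.1, disj hρ ht.2.2⟩
  | letp t u iht ihu =>
    obtain ⟨h₁, h₂, o₀, o₁, d⟩ := ht
    refine ⟨iht hρ h₁, ihu (lift (lift hρ)) h₂, (occurs_rename _ _ _).2 ⟨0, o₀, rfl⟩,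
      (occurs_rename _ _ _).2 ⟨1, o₁, rfl⟩, ?_⟩
    rintro i ⟨h₁, h₂⟩
    obtain ⟨j, hj, rfl⟩ := (occurs_rename _ _ _).1 h₁
    obtain ⟨_ | _ | k, hk, e⟩ := (occurs_rename _ _ _).1 h₂
    · simp [liftRen] at e
    · simp [liftRen] at e
    · have e : ρ j = ρ k := by simpa [liftRen] using e
      exact d j ⟨hj, by rwa [hρ e]⟩

theorem linear_subst {σ : ℕ → Tm} (hσ : ∀ i, (σ i).Linear)
    (hd : ∀ i j, i ≠ j → FVDisjoint (σ i) (σ j)) {t : Tm} (ht : t.Linear) :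
    (subst σ t).Linear := by
  have lift : ∀ {σ : ℕ → Tm}, ((∀ i, (σ i).Linear) ∧ ∀ i j, i ≠ j → FVDisjoint (σ i) (σ j)) →
      (∀ i, (liftSub σ i).Linear) ∧
        ∀ i j, i ≠ j → FVDisjoint (liftSub σ i) (liftSub σ j) := by
    rintro σ ⟨hσ, hd⟩
    refine ⟨?_, ?_⟩
    · rintro (_ | i)
      · trivial
      · exact linear_rename Nat.succ_injective (hσ i)
    · rintro i j hij (_ | k) ⟨h₁, h₂⟩
      · rw [occurs_zero_liftSub] at h₁ h₂
        exact hij (h₁.trans h₂.symm)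
      · rcases i with _ | i
        · simp [liftSub, occurs] at h₁
        rcases j with _ | j
        · simp [liftSub, occurs] at h₂
        simp only [liftSub, occurs_succ_rename_succ] at h₁ h₂
        exact hd i j (by omega) k ⟨h₁, h₂⟩
  have disj : ∀ {σ : ℕ → Tm} {t u : Tm}, (∀ i j, i ≠ j → FVDisjoint (σ i) (σ j)) →
      FVDisjoint t u → FVDisjoint (subst σ t) (subst σ u) := by
    rintro σ t u hd h i ⟨h₁, h₂⟩
    obtain ⟨j, hj, ej⟩ := (occurs_subst _ _ _).1 h₁
    obtain ⟨k, hk, ek⟩ := (occurs_subst _ _ _).1 h₂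
    rcases eq_or_ne j k with rfl | hjk
    · exact h j ⟨hj, hk⟩
    · exact hd j k hjk i ⟨ej, ek⟩
  induction t generalizing σ with
  | var j => exact hσ j
  | zero => trivial
  | suc t iht => exact iht hσ hd ht
  | recur t u v w iht ihu ihv ihw =>
    obtain ⟨⟨h₁, h₂, h₃, h₄⟩, d₁, d₂, d₃, d₄, d₅, d₆⟩ := ht
    exact ⟨⟨iht hσ hd h₁, ihu hσ hd h₂, ihv hσ hd h₃, ihw hσ hd h₄⟩, disj hd d₁, disj hd d₂,
      disj hd d₃, disj hd d₄, disj hd d₅, disj hd d₆⟩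
  | app t u iht ihu => exact ⟨iht hσ hd ht.1, ihu hσ hd ht.2.1, disj hd ht.2.2⟩
  | lam t iht =>
    have l := lift ⟨hσ, hd⟩
    exact ⟨iht l.1 l.2 ht.1, by rw [occurs_zero_subst_liftSub]; exact ht.2⟩
  | pair t u iht ihu => exact ⟨iht hσ hd ht.1, ihu hσ hd ht.2.1, disj hd ht.2.2⟩
  | letp t u iht ihu =>
    obtain ⟨h₁, h₂, o₀, o₁, d⟩ := ht
    have l := lift (lift ⟨hσ, hd⟩)
    refine ⟨iht hσ hd h₁, ihu l.1 l.2 h₂, by rw [occurs_zero_subst_liftSub]; exact o₀,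
      by rw [occurs_one_subst_liftSub_liftSub]; exact o₁, ?_⟩
    rintro i ⟨h₁, h₂⟩
    obtain ⟨j, hj, ej⟩ := (occurs_subst _ _ _).1 h₁
    rw [occurs_subst, show i + 2 = i + 1 + 1 from rfl, exists_occurs_liftSub,
      exists_occurs_liftSub] at h₂
    obtain ⟨k, hk, ek⟩ := h₂
    rcases eq_or_ne j k with rfl | hjk
    · exact d j ⟨hj, hk⟩
    · exact hd j k hjk i ⟨ej, ek⟩

theorem occurs_inst {t v : Tm} (hv : v.Closed) (i : ℕ) :
    occurs i (inst t v) = occurs (i + 1) t := by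
  rw [Bool.eq_iff_iff, inst, occurs_subst]
  constructor
  · rintro ⟨_ | j, h, e⟩
    · simp [consSub, hv i] at e
    · have e : i = j := by simpa [consSub, occurs] using e
      rwa [e]
  · exact fun h => ⟨i + 1, h, by simp [consSub, occurs]⟩

theorem occurs_inst₂ {v t u : Tm} (ht : t.Closed) (hu : u.Closed) (i : ℕ) :
    occurs i (inst₂ v t u) = occurs (i + 2) v := by
  rw [Bool.eq_iff_iff, inst₂, occurs_subst]
  constructor
  · rintro ⟨_ | _ | j, h, e⟩
    · simp [consSub, hu i] at e
    · simp [consSub, ht i] at e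
    · have e : i = j := by simpa [consSub, occurs] using e
      rwa [e]
  · exact fun h => ⟨i + 2, h, by simp [consSub, occurs]⟩

theorem linear_consSub {v : Tm} {σ : ℕ → Tm} (hv : v.Closed) (hv' : v.Linear)
    (h : (∀ i, (σ i).Linear) ∧ ∀ i j, i ≠ j → FVDisjoint (σ i) (σ j)) :
    (∀ i, (consSub v σ i).Linear) ∧
      ∀ i j, i ≠ j → FVDisjoint (consSub v σ i) (consSub v σ j) := by
  refine ⟨?_, ?_⟩
  · rintro (_ | i)
    · exact hv'
    · exact h.1 i
  · rintro (_ | i) (_ | j) hij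
    · exact absurd rfl hij
    · exact hv.fvDisjoint_left _
    · exact hv.fvDisjoint_right _
    · exact h.2 i j (by omega)

theorem linear_var_family :
    (∀ i, (var i).Linear) ∧ ∀ i j, i ≠ j → FVDisjoint (var i) (var j) :=
  ⟨fun _ => trivial, fun i j hij k hk => hij (by simp [occurs] at hk; omega)⟩

theorem linear_inst {t v : Tm} (ht : t.Linear) (hv : v.Closed) (hv' : v.Linear) :
    (inst t v).Linear :=
  have l := linear_consSub hv hv' linear_var_family
  linear_subst l.1 l.2 ht

theorem linear_inst₂ {v t u : Tm} (hv : v.Linear) (ht : t.Closed) (ht' : t.Linear)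
    (hu : u.Closed) (hu' : u.Linear) : (inst₂ v t u).Linear :=
  have l := linear_consSub hu hu' (linear_consSub ht ht' linear_var_family)
  linear_subst l.1 l.2 hv

end Tm

/-! ### Closed reduction -/

open Tm

/-- On linear terms, reduction neither creates nor discards free variables: every bound variable
is used, and a recursor discards closed terms only. Hence linearity is preserved too. -/
theorem Step.linear_occurs {t u : Tm} (h : Step t u) (ht : t.Linear) :
    u.Linear ∧ ∀ i, occurs i u = occurs i t := by
  induction h with
  | @beta t v hv =>
    obtain ⟨⟨h₁, -⟩, h₂, -⟩ := ht
    exact ⟨linear_inst h₁ hv h₂, fun i => by simp [occurs_inst hv, occurs, hv i]⟩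
  | @letPair t u v ht' hu' =>
    obtain ⟨⟨h₁, h₂, -⟩, h₃, -⟩ := ht
    exact ⟨linear_inst₂ h₃ ht' h₁ hu' h₂, fun i => by
      simp [occurs_inst₂ ht' hu', occurs, ht' i, hu' i]⟩
  | recZero h₁ h₂ h₃ => exact ⟨ht.1.2.1, fun i => by simp [occurs, h₁ i, h₂ i, h₃ i]⟩
  | recSuc hv hw =>
    obtain ⟨⟨h₁, h₂, h₃, h₄⟩, d₁, -⟩ := ht
    refine ⟨⟨h₃, ⟨⟨⟨h₄, h₁, hw.fvDisjoint_left _⟩, h₂, h₃, h₄⟩, ?_, hv.fvDisjoint_right _,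
      hw.fvDisjoint_right _, hv.fvDisjoint_right _, hw.fvDisjoint_right _,
      hw.fvDisjoint_right _⟩, hv.fvDisjoint_left _⟩, fun i => by simp [occurs, hv i, hw i]⟩
    intro i hi
    exact d₁ i (by simpa [occurs, hw i] using hi)
  | suc _ ih => exact ih ht
  | rec₁ _ ih | rec₂ _ ih | rec₃ _ ih | rec₄ _ ih =>
    obtain ⟨⟨h₁, h₂, h₃, h₄⟩, d⟩ := ht
    first
      | obtain ⟨l, o⟩ := ih h₁
        exact ⟨⟨⟨l, h₂, h₃, h₄⟩, by simpa only [FVDisjoint, o] using d⟩,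
          fun i => by simp only [occurs, o]⟩
      | obtain ⟨l, o⟩ := ih h₂
        exact ⟨⟨⟨h₁, l, h₃, h₄⟩, by simpa only [FVDisjoint, o] using d⟩,
          fun i => by simp only [occurs, o]⟩
      | obtain ⟨l, o⟩ := ih h₃
        exact ⟨⟨⟨h₁, h₂, l, h₄⟩, by simpa only [FVDisjoint, o] using d⟩,
          fun i => by simp only [occurs, o]⟩
      | obtain ⟨l, o⟩ := ih h₄
        exact ⟨⟨⟨h₁, h₂, h₃, l⟩, by simpa only [FVDisjoint, o] using d⟩,
          fun i => by simp only [occurs, o]⟩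
  | app₁ _ ih | pair₁ _ ih =>
    obtain ⟨h₁, h₂, d⟩ := ht
    obtain ⟨l, o⟩ := ih h₁
    exact ⟨⟨l, h₂, by simpa only [FVDisjoint, o] using d⟩, fun i => by simp only [occurs, o]⟩
  | app₂ _ ih | pair₂ _ ih =>
    obtain ⟨h₁, h₂, d⟩ := ht
    obtain ⟨l, o⟩ := ih h₂
    exact ⟨⟨h₁, l, by simpa only [FVDisjoint, o] using d⟩, fun i => by simp only [occurs, o]⟩
  | lam _ ih =>
    obtain ⟨l, o⟩ := ih ht.1
    exact ⟨⟨l, by rw [o]; exact ht.2⟩, fun i => by simp only [occurs, o]⟩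
  | let₁ _ ih =>
    obtain ⟨h₁, h₂, o₀, o₁, d⟩ := ht
    obtain ⟨l, o⟩ := ih h₁
    exact ⟨⟨l, h₂, o₀, o₁, by simpa only [o] using d⟩, fun i => by simp only [occurs, o]⟩
  | let₂ _ ih =>
    obtain ⟨h₁, h₂, o₀, o₁, d⟩ := ht
    obtain ⟨l, o⟩ := ih h₂
    exact ⟨⟨h₁, l, by rwa [o], by rwa [o], by simpa only [o] using d⟩,
      fun i => by simp only [occurs, o]⟩

/-- Reduction in any number of steps. -/
abbrev Red : Tm → Tm → Prop := Relation.ReflTransGen Step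

theorem Red.linear_occurs {t u : Tm} (h : Red t u) (ht : t.Linear) :
    u.Linear ∧ ∀ i, occurs i u = occurs i t := by
  induction h with
  | refl => exact ⟨ht, fun _ => rfl⟩
  | tail _ h ih =>
    obtain ⟨l, o⟩ := h.linear_occurs ih.1
    exact ⟨l, fun i => (o i).trans (ih.2 i)⟩

namespace Red

variable {t t' u u' v v' w w' : Tm}

theorem suc (h : Red t t') : Red (.suc t) (.suc t') := h.lift _ fun _ _ => .suc

theorem lam (h : Red t t') : Red (.lam t) (.lam t') := h.lift _ fun _ _ => .lam

theorem app (h₁ : Red t t') (h₂ : Red u u') : Red (.app t u) (.app t' u') :=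
  (h₁.lift (Tm.app · u) fun _ _ => .app₁).trans (h₂.lift (Tm.app t') fun _ _ => .app₂)

theorem pair (h₁ : Red t t') (h₂ : Red u u') : Red (.pair t u) (.pair t' u') :=
  (h₁.lift (Tm.pair · u) fun _ _ => .pair₁).trans (h₂.lift (Tm.pair t') fun _ _ => .pair₂)

theorem letp (h₁ : Red t t') (h₂ : Red u u') : Red (.letp t u) (.letp t' u') :=
  (h₁.lift (Tm.letp · u) fun _ _ => .let₁).trans (h₂.lift (Tm.letp t') fun _ _ => .let₂)

theorem recur (h₁ : Red t t') (h₂ : Red u u') (h₃ : Red v v') (h₄ : Red w w') :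
    Red (.recur t u v w) (.recur t' u' v' w') :=
  (((h₁.lift (Tm.recur · u v w) fun _ _ => .rec₁).trans
    (h₂.lift (Tm.recur t' · v w) fun _ _ => .rec₂)).trans
    (h₃.lift (Tm.recur t' u' · w) fun _ _ => .rec₃)).trans
    (h₄.lift (Tm.recur t' u' v' ·) fun _ _ => .rec₄)

end Red

/-! ### Convertibility -/

theorem Red.conv {t u : Tm} (h : Red t u) (ht : t.Linear) : Conv t u := by
  refine ⟨ht, (h.linear_occurs ht).1, ?_⟩
  induction h with
  | refl => exact .refl _
  | tail h₁ h₂ ih =>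
    have l := (Red.linear_occurs h₁ ht).1
    exact .trans _ _ _ ih (.rel _ _ ⟨l, (h₂.linear_occurs l).1, h₂⟩)

theorem Conv.symm {t u : Tm} (h : Conv t u) : Conv u t := ⟨h.2.1, h.1, .symm _ _ h.2.2⟩

theorem Conv.trans {t u v : Tm} (h₁ : Conv t u) (h₂ : Conv u v) : Conv t v :=
  ⟨h₁.1, h₂.2.1, .trans _ _ _ h₁.2.2 h₂.2.2⟩

theorem Conv.map {f : Tm → Tm} (hl : ∀ t, t.Linear → (f t).Linear)
    (hf : ∀ t u, Step t u → Step (f t) (f u)) {t u : Tm} (h : Conv t u) :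
    Conv (f t) (f u) := by
  obtain ⟨h₁, h₂, h⟩ := h
  refine ⟨hl _ h₁, hl _ h₂, ?_⟩
  clear h₁ h₂
  induction h with
  | rel a b h => exact .rel _ _ ⟨hl _ h.1, hl _ h.2.1, hf _ _ h.2.2⟩
  | refl a => exact .refl _
  | symm a b _ ih => exact .symm _ _ ih
  | trans a b c _ _ ih₁ ih₂ => exact .trans _ _ _ ih₁ ih₂

theorem Conv.app_left {t t' u : Tm} (h : Conv t t') (hu : u.Linear) (hu' : u.Closed) :
    Conv (app t u) (app t' u) :=
  h.map (f := fun t => app t u) (fun _ ht => ⟨ht, hu, hu'.fvDisjoint_right _⟩)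
    fun _ _ => .app₁

theorem Conv.app_right {t u u' : Tm} (h : Conv u u') (ht : t.Linear) (ht' : t.Closed) :
    Conv (app t u) (app t u') :=
  h.map (f := app t) (fun _ hu => ⟨ht, hu, ht'.fvDisjoint_left _⟩) fun _ _ => .app₂

end Lrec

/-! ### Weak head reduction -/

namespace Lrec

open Tm

/-- One step of weak head reduction: the strategy that call-by-name evaluation follows. It is the
part of closed reduction that fires the leftmost-outermost redex, and it is kept under the
closedness conditions of closed reduction so that it makes sense on open terms too. -/
inductive WHead : Tm → Tm → Prop
  | beta {t v : Tm} : v.Closed → WHead (app (lam t) v) (inst t v)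
  | letPair {t u v : Tm} : t.Closed → u.Closed → WHead (letp (pair t u) v) (inst₂ v t u)
  | recZero {t' u v w : Tm} : t'.Closed → v.Closed → w.Closed →
      WHead (recur (pair zero t') u v w) u
  | recSuc {t t' u v w : Tm} : v.Closed → w.Closed →
      WHead (recur (pair (suc t) t') u v w) (app v (recur (app w (pair t t')) u v w))
  | app {t t' u : Tm} : WHead t t' → WHead (app t u) (app t' u)
  | letp {t t' u : Tm} : WHead t t' → WHead (letp t u) (letp t' u)
  | recur {t t' u v w : Tm} : WHead t t' → WHead (recur t u v w) (recur t' u v w)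
  | recPair {t t' s u v w : Tm} : WHead t t' →
      WHead (recur (pair t s) u v w) (recur (pair t' s) u v w)

/-- Weak head reduction in any number of steps. -/
abbrev WHeads : Tm → Tm → Prop := Relation.ReflTransGen WHead

theorem WHead.step {t u : Tm} (h : WHead t u) : Step t u := by
  induction h with
  | beta h => exact .beta h
  | letPair h₁ h₂ => exact .letPair h₁ h₂
  | recZero h₁ h₂ h₃ => exact .recZero h₁ h₂ h₃
  | recSuc h₁ h₂ => exact .recSuc h₁ h₂
  | app _ ih => exact .app₁ ih
  | letp _ ih => exact .let₁ ih
  | recur _ ih => exact .rec₁ ih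
  | recPair _ ih => exact .rec₁ (.pair₁ ih)

theorem WHeads.red {t u : Tm} (h : WHeads t u) : Red t u := h.lift id fun _ _ h => h.step

theorem IsValue.not_wHead {V t : Tm} (hV : IsValue V) : ¬ WHead V t := by
  intro h; cases hV <;> cases h

theorem WHead.deterministic {t u u' : Tm} (h : WHead t u) (h' : WHead t u') : u = u' := by
  induction h generalizing u' with
  | beta _ | letPair _ _ | recZero _ _ _ | recSuc _ _ =>
    cases h' <;> first | rfl | (rename_i h; cases h)
  | app h ih =>
    cases h' with
    | beta => cases h
    | app h' => rw [ih h']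
  | letp h ih =>
    cases h' with
    | letPair => cases h
    | letp h' => rw [ih h']
  | recur h ih =>
    cases h' with
    | recur h' => rw [ih h']
    | _ => cases h
  | recPair h ih =>
    cases h' with
    | recPair h' => rw [ih h']
    | recur h' => cases h'
    | _ => cases h

theorem Tm.Closed.subst {t : Tm} (h : t.Closed) (σ : ℕ → Tm) : (subst σ t).Closed := by
  rwa [h.subst_eq]

theorem WHead.subst {t u : Tm} (h : WHead t u) (σ : ℕ → Tm) :
    WHead (subst σ t) (subst σ u) := by
  induction h with
  | beta h => rw [subst_inst]; exact .beta (h.subst σ)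
  | letPair h₁ h₂ => rw [subst_inst₂]; exact .letPair (h₁.subst σ) (h₂.subst σ)
  | recZero h₁ h₂ h₃ => exact .recZero (h₁.subst σ) (h₂.subst σ) (h₃.subst σ)
  | recSuc h₁ h₂ => exact .recSuc (h₁.subst σ) (h₂.subst σ)
  | app _ ih => exact .app ih
  | letp _ ih => exact .letp ih
  | recur _ ih => exact .recur ih
  | recPair _ ih => exact .recPair ih

namespace WHeads

variable {t t' s u v w : Tm}

theorem subst (h : WHeads t u) (σ : ℕ → Tm) : WHeads (subst σ t) (subst σ u) :=
  h.lift _ fun _ _ h => h.subst σ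

theorem rename (h : WHeads t u) (ρ : ℕ → ℕ) : WHeads (rename ρ t) (rename ρ u) := by
  simpa only [rename_eq_subst] using WHeads.subst h _

theorem app (h : WHeads t t') : WHeads (.app t u) (.app t' u) :=
  h.lift (Tm.app · u) fun _ _ => .app

theorem letp (h : WHeads t t') : WHeads (.letp t u) (.letp t' u) :=
  h.lift (Tm.letp · u) fun _ _ => .letp

theorem recur (h : WHeads t t') : WHeads (.recur t u v w) (.recur t' u v w) :=
  h.lift (Tm.recur · u v w) fun _ _ => .recur

theorem recPair (h : WHeads t t') :
    WHeads (.recur (.pair t s) u v w) (.recur (.pair t' s) u v w) :=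
  h.lift (fun t => Tm.recur (.pair t s) u v w) fun _ _ => .recPair

end WHeads

theorem BigStep.eq_of_isValue {V W : Tm} (hV : IsValue V) (h : BigStep V W) : W = V := by
  cases h <;> first | rfl | cases hV

theorem BigStep.of_wHead {t u V : Tm} (h : WHead t u) (hu : BigStep u V) : BigStep t V := by
  induction h generalizing V with
  | beta _ => exact .app (.val (.lam _)) hu
  | letPair _ _ =>
    refine .letp (.val (.pair _ _)) (.app (.app (.val (.lam _)) (.val (.lam _))) ?_)
    rwa [inst_subst_liftSub]
  | recZero _ _ _ => exact .rec₁ (.val (.pair _ _)) (.val .zero) hu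
  | recSuc _ _ => exact .rec₂ (.val (.pair _ _)) (.val (.suc _)) hu
  | app _ ih =>
    cases hu with
    | val h => cases h
    | app h₁ h₂ => exact .app (ih h₁) h₂
  | letp _ ih =>
    cases hu with
    | val h => cases h
    | letp h₁ h₂ => exact .letp (ih h₁) h₂
  | recur _ ih =>
    cases hu with
    | val h => cases h
    | rec₁ h₁ h₂ h₃ => exact .rec₁ (ih h₁) h₂ h₃
    | rec₂ h₁ h₂ h₃ => exact .rec₂ (ih h₁) h₂ h₃
  | recPair _ ih =>
    cases hu with
    | val h => cases h
    | rec₁ h₁ h₂ h₃ =>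
      cases h₁.eq_of_isValue (.pair _ _)
      exact .rec₁ (.val (.pair _ _)) (ih h₂) h₃
    | rec₂ h₁ h₂ h₃ =>
      cases h₁.eq_of_isValue (.pair _ _)
      exact .rec₂ (.val (.pair _ _)) (ih h₂) h₃

theorem WHeads.bigStep {t V : Tm} (h : WHeads t V) (hV : IsValue V) : BigStep t V := by
  induction h using Relation.ReflTransGen.head_induction_on with
  | refl => exact .val hV
  | head h _ ih => exact .of_wHead h ih

/-! ### Standardization -/

/-- Standard reduction: `t` is brought by weak head reduction to a term with the outermost
constructor of the target, and then its immediate subterms are reduced in the same manner. -/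
inductive Std : Tm → Tm → Prop
  | var {t : Tm} {i : ℕ} : WHeads t (var i) → Std t (var i)
  | zero {t : Tm} : WHeads t zero → Std t zero
  | suc {t a a' : Tm} : WHeads t (suc a) → Std a a' → Std t (suc a')
  | recur {t a b c d a' b' c' d' : Tm} : WHeads t (recur a b c d) →
      Std a a' → Std b b' → Std c c' → Std d d' → Std t (recur a' b' c' d')
  | app {t a b a' b' : Tm} : WHeads t (app a b) → Std a a' → Std b b' → Std t (app a' b')
  | lam {t a a' : Tm} : WHeads t (lam a) → Std a a' → Std t (lam a')
  | pair {t a b a' b' : Tm} : WHeads t (pair a b) → Std a a' → Std b b' → Std t (pair a' b')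
  | letp {t a b a' b' : Tm} : WHeads t (letp a b) → Std a a' → Std b b' → Std t (letp a' b')

namespace Std

theorem head {t t' u : Tm} (h : WHeads t t') (hu : Std t' u) : Std t u := by
  cases hu with
  | var h' => exact .var (h.trans h')
  | zero h' => exact .zero (h.trans h')
  | suc h' h₁ => exact .suc (h.trans h') h₁
  | recur h' h₁ h₂ h₃ h₄ => exact .recur (h.trans h') h₁ h₂ h₃ h₄
  | app h' h₁ h₂ => exact .app (h.trans h') h₁ h₂
  | lam h' h₁ => exact .lam (h.trans h') h₁
  | pair h' h₁ h₂ => exact .pair (h.trans h') h₁ h₂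
  | letp h' h₁ h₂ => exact .letp (h.trans h') h₁ h₂

theorem refl (t : Tm) : Std t t := by
  induction t with
  | var i => exact .var .refl
  | zero => exact .zero .refl
  | suc _ h₁ => exact .suc .refl h₁
  | recur _ _ _ _ h₁ h₂ h₃ h₄ => exact .recur .refl h₁ h₂ h₃ h₄
  | app _ _ h₁ h₂ => exact .app .refl h₁ h₂
  | lam _ h₁ => exact .lam .refl h₁
  | pair _ _ h₁ h₂ => exact .pair .refl h₁ h₂
  | letp _ _ h₁ h₂ => exact .letp .refl h₁ h₂

theorem red {t u : Tm} (h : Std t u) : Red t u := by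
  induction h with
  | var h' => exact h'.red
  | zero h' => exact h'.red
  | suc h' _ h₁ => exact h'.red.trans h₁.suc
  | recur h' _ _ _ _ h₁ h₂ h₃ h₄ => exact h'.red.trans (Red.recur h₁ h₂ h₃ h₄)
  | app h' _ _ h₁ h₂ => exact h'.red.trans (Red.app h₁ h₂)
  | lam h' _ h₁ => exact h'.red.trans (Red.lam h₁)
  | pair h' _ _ h₁ h₂ => exact h'.red.trans (Red.pair h₁ h₂)
  | letp h' _ _ h₁ h₂ => exact h'.red.trans (Red.letp h₁ h₂)

theorem rename {t u : Tm} (h : Std t u) (ρ : ℕ → ℕ) : Std (rename ρ t) (rename ρ u) := by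
  induction h generalizing ρ with
  | var h' => exact .var (h'.rename ρ)
  | zero h' => exact .zero (h'.rename ρ)
  | suc h' _ h₁ => exact .suc (h'.rename ρ) (h₁ ρ)
  | recur h' _ _ _ _ h₁ h₂ h₃ h₄ => exact .recur (h'.rename ρ) (h₁ ρ) (h₂ ρ) (h₃ ρ) (h₄ ρ)
  | app h' _ _ h₁ h₂ => exact .app (h'.rename ρ) (h₁ ρ) (h₂ ρ)
  | lam h' _ h₁ => exact .lam (h'.rename ρ) (h₁ _)
  | pair h' _ _ h₁ h₂ => exact .pair (h'.rename ρ) (h₁ ρ) (h₂ ρ)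
  | letp h' _ _ h₁ h₂ => exact .letp (h'.rename ρ) (h₁ ρ) (h₂ _)

theorem liftSub {σ τ : ℕ → Tm} (h : ∀ i, Std (σ i) (τ i)) (i : ℕ) :
    Std (liftSub σ i) (liftSub τ i) := by
  cases i with
  | zero => exact .refl _
  | succ i => exact (h i).rename _

theorem subst {t u : Tm} (h : Std t u) {σ τ : ℕ → Tm} (hσ : ∀ i, Std (σ i) (τ i)) :
    Std (subst σ t) (subst τ u) := by
  induction h generalizing σ τ with
  | var h' => exact .head (h'.subst σ) (hσ _)
  | zero h' => exact .zero (h'.subst σ)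
  | suc h' _ h₁ => exact .suc (h'.subst σ) (h₁ hσ)
  | recur h' _ _ _ _ h₁ h₂ h₃ h₄ =>
    exact .recur (h'.subst σ) (h₁ hσ) (h₂ hσ) (h₃ hσ) (h₄ hσ)
  | app h' _ _ h₁ h₂ => exact .app (h'.subst σ) (h₁ hσ) (h₂ hσ)
  | lam h' _ h₁ => exact .lam (h'.subst σ) (h₁ (liftSub hσ))
  | pair h' _ _ h₁ h₂ => exact .pair (h'.subst σ) (h₁ hσ) (h₂ hσ)
  | letp h' _ _ h₁ h₂ => exact .letp (h'.subst σ) (h₁ hσ) (h₂ (liftSub (liftSub hσ)))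

theorem consSub {σ τ : ℕ → Tm} {v v' : Tm} (hv : Std v v') (h : ∀ i, Std (σ i) (τ i)) (i : ℕ) :
    Std (consSub v σ i) (consSub v' τ i) := by
  cases i with
  | zero => exact hv
  | succ i => exact h i

theorem inst {t t' v v' : Tm} (ht : Std t t') (hv : Std v v') :
    Std (inst t v) (inst t' v') := ht.subst (consSub hv fun _ => .refl _)

theorem inst₂ {v v' t t' u u' : Tm} (hv : Std v v') (ht : Std t t') (hu : Std u u') :
    Std (inst₂ v t u) (inst₂ v' t' u') :=
  hv.subst (consSub hu (consSub ht fun _ => .refl _))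

theorem closed_iff {t u : Tm} (h : Std t u) (ht : t.Linear) : u.Closed ↔ t.Closed := by
  simp only [Closed, (h.red.linear_occurs ht).2]

end Std

/-- Standard reduction absorbs one more step of reduction. Linearity is what makes this true: the
reducts of a linear term have the same free variables, so that a redex whose closedness
conditions hold after some reductions inside its parts satisfied them before. -/
theorem Std.step {t u u' : Tm} (ht : t.Linear) (h : Std t u) (hu : Step u u') : Std t u' := by
  have lin : ∀ {t u : Tm}, t.Linear → WHeads t u → u.Linear :=
    fun ht h => (h.red.linear_occurs ht).1
  induction hu generalizing t with
  | beta hv =>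
    obtain _ | _ | _ | _ | ⟨w, h₁, h₂⟩ := h
    obtain _ | _ | _ | _ | _ | ⟨w₁, h₁⟩ := h₁
    obtain ⟨-, l, -⟩ := lin ht w
    exact .head ((w.trans w₁.app).tail (.beta ((h₂.closed_iff l).1 hv))) (h₁.inst h₂)
  | letPair hp hq =>
    obtain _ | _ | _ | _ | _ | _ | _ | ⟨w, h₁, h₂⟩ := h
    obtain _ | _ | _ | _ | _ | _ | ⟨w₁, h₁, h₃⟩ := h₁
    obtain ⟨⟨l₁, l₃, -⟩, -⟩ := lin ht (w.trans w₁.letp)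
    exact .head ((w.trans w₁.letp).tail
      (.letPair ((h₁.closed_iff l₁).1 hp) ((h₃.closed_iff l₃).1 hq))) (h₂.inst₂ h₁ h₃)
  | recZero hp hv hw =>
    obtain _ | _ | _ | ⟨w, h₁, h₂, h₃, h₄⟩ := h
    obtain _ | _ | _ | _ | _ | _ | ⟨w₁, h₁, h₅⟩ := h₁
    obtain _ | w₂ := h₁
    have w := (w.trans w₁.recur).trans w₂.recPair
    obtain ⟨⟨⟨-, l₅, -⟩, -, l₃, l₄⟩, -⟩ := lin ht w
    exact .head (w.tail (.recZero ((h₅.closed_iff l₅).1 hp) ((h₃.closed_iff l₃).1 hv)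
      ((h₄.closed_iff l₄).1 hw))) h₂
  | recSuc hv hw =>
    obtain _ | _ | _ | ⟨w, h₁, h₂, h₃, h₄⟩ := h
    obtain _ | _ | _ | _ | _ | _ | ⟨w₁, h₁, h₅⟩ := h₁
    obtain _ | _ | ⟨w₂, h₁⟩ := h₁
    have w := (w.trans w₁.recur).trans w₂.recPair
    obtain ⟨⟨-, -, l₃, l₄⟩, -⟩ := lin ht w
    exact .head (w.tail (.recSuc ((h₃.closed_iff l₃).1 hv) ((h₄.closed_iff l₄).1 hw)))
      (.app .refl h₃ (.recur .refl (.app .refl h₄ (.pair .refl h₁ h₅)) h₂ h₃ h₄))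
  | suc _ ih =>
    obtain _ | _ | ⟨w, h₁⟩ := h
    have l := lin ht w
    exact .suc w (ih (by exact l) h₁)
  | rec₁ _ ih | rec₂ _ ih | rec₃ _ ih | rec₄ _ ih =>
    obtain _ | _ | _ | ⟨w, h₁, h₂, h₃, h₄⟩ := h
    obtain ⟨⟨l₁, l₂, l₃, l₄⟩, -⟩ := lin ht w
    first
      | exact .recur w (ih l₁ h₁) h₂ h₃ h₄
      | exact .recur w h₁ (ih l₂ h₂) h₃ h₄
      | exact .recur w h₁ h₂ (ih l₃ h₃) h₄
      | exact .recur w h₁ h₂ h₃ (ih l₄ h₄)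
  | app₁ _ ih | app₂ _ ih =>
    obtain _ | _ | _ | _ | ⟨w, h₁, h₂⟩ := h
    obtain ⟨l₁, l₂, -⟩ := lin ht w
    first
      | exact .app w (ih l₁ h₁) h₂
      | exact .app w h₁ (ih l₂ h₂)
  | lam _ ih =>
    obtain _ | _ | _ | _ | _ | ⟨w, h₁⟩ := h
    exact .lam w (ih (lin ht w).1 h₁)
  | pair₁ _ ih | pair₂ _ ih =>
    obtain _ | _ | _ | _ | _ | _ | ⟨w, h₁, h₂⟩ := h
    obtain ⟨l₁, l₂, -⟩ := lin ht w
    first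
      | exact .pair w (ih l₁ h₁) h₂
      | exact .pair w h₁ (ih l₂ h₂)
  | let₁ _ ih | let₂ _ ih =>
    obtain _ | _ | _ | _ | _ | _ | _ | ⟨w, h₁, h₂⟩ := h
    obtain ⟨l₁, l₂, -⟩ := lin ht w
    first
      | exact .letp w (ih l₁ h₁) h₂
      | exact .letp w h₁ (ih l₂ h₂)

theorem Red.std {t u : Tm} (h : Red t u) (ht : t.Linear) : Std t u := by
  induction h with
  | refl => exact .refl t
  | tail _ h ih => exact ih.step ht h

/-- The two terms have the same outermost constructor, and the immediate subterms of the first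
reduce to those of the second by standard reduction. -/
inductive Std.Cong : Tm → Tm → Prop
  | var (i : ℕ) : Cong (Tm.var i) (Tm.var i)
  | zero : Cong Tm.zero Tm.zero
  | suc {a a' : Tm} : Std a a' → Cong (Tm.suc a) (Tm.suc a')
  | recur {a b c d a' b' c' d' : Tm} :
      Std a a' → Std b b' → Std c c' → Std d d' → Cong (Tm.recur a b c d) (Tm.recur a' b' c' d')
  | app {a b a' b' : Tm} : Std a a' → Std b b' → Cong (Tm.app a b) (Tm.app a' b')
  | lam {a a' : Tm} : Std a a' → Cong (Tm.lam a) (Tm.lam a')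
  | pair {a b a' b' : Tm} : Std a a' → Std b b' → Cong (Tm.pair a b) (Tm.pair a' b')
  | letp {a b a' b' : Tm} : Std a a' → Std b b' → Cong (Tm.letp a b) (Tm.letp a' b')

namespace Std

theorem Cong.std {t u : Tm} (h : Cong t u) : Std t u := by
  cases h with
  | var => exact .refl _
  | zero => exact .refl _
  | suc h₁ => exact .suc .refl h₁
  | recur h₁ h₂ h₃ h₄ => exact .recur .refl h₁ h₂ h₃ h₄
  | app h₁ h₂ => exact .app .refl h₁ h₂
  | lam h₁ => exact .lam .refl h₁
  | pair h₁ h₂ => exact .pair .refl h₁ h₂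
  | letp h₁ h₂ => exact .letp .refl h₁ h₂

theorem exists_cong {t u : Tm} (h : Std t u) : ∃ t', WHeads t t' ∧ Cong t' u := by
  cases h with
  | var w => exact ⟨_, w, .var _⟩
  | zero w => exact ⟨_, w, .zero⟩
  | suc w h₁ => exact ⟨_, w, .suc h₁⟩
  | recur w h₁ h₂ h₃ h₄ => exact ⟨_, w, .recur h₁ h₂ h₃ h₄⟩
  | app w h₁ h₂ => exact ⟨_, w, .app h₁ h₂⟩
  | lam w h₁ => exact ⟨_, w, .lam h₁⟩
  | pair w h₁ h₂ => exact ⟨_, w, .pair h₁ h₂⟩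
  | letp w h₁ h₂ => exact ⟨_, w, .letp h₁ h₂⟩

theorem Cong.isValue_iff {t u : Tm} (h : Cong t u) : IsValue t ↔ IsValue u := by
  constructor <;> intro hV <;> cases hV <;> cases h <;> constructor

theorem cong_of_isValue {V u : Tm} (h : Std V u) (hV : IsValue V) : Cong V u := by
  obtain ⟨t', w, h⟩ := h.exists_cong
  rcases w.cases_head with rfl | ⟨_, w, _⟩
  · exact h
  · exact absurd w hV.not_wHead

theorem of_wHead_or_cong {t t₁ u : Tm} (h : Std t u) (w : WHead t t₁) :
    Std t₁ u ∨ Cong t u := by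
  obtain ⟨t', w', h⟩ := h.exists_cong
  rcases w'.cases_head with rfl | ⟨_, w₁, w'⟩
  · exact .inr h
  · cases w.deterministic w₁
    exact .inl (.head w' h.std)

/-- Weak head reduction of `t` is followed by weak head reduction of the standard reducts of `t`. -/
theorem exists_wHeads {t t₁ u : Tm} (w : WHead t t₁) (ht : t.Linear) (h : Std t u) :
    ∃ u₁, WHeads u u₁ ∧ Std t₁ u₁ := by
  induction w generalizing u with
  | beta hv =>
    obtain h | h := h.of_wHead_or_cong (.beta hv)
    · exact ⟨u, .refl, h⟩
    obtain _ | _ | _ | _ | ⟨g₁, h₂⟩ := h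
    obtain _ | _ | _ | _ | _ | h₁ := g₁.cong_of_isValue (.lam _)
    exact ⟨_, .single (.beta ((h₂.closed_iff ht.2.1).2 hv)), h₁.inst h₂⟩
  | letPair hp hq =>
    obtain h | h := h.of_wHead_or_cong (.letPair hp hq)
    · exact ⟨u, .refl, h⟩
    obtain _ | _ | _ | _ | _ | _ | _ | ⟨g₁, h₂⟩ := h
    obtain _ | _ | _ | _ | _ | _ | ⟨h₁, h₃⟩ := g₁.cong_of_isValue (.pair _ _)
    obtain ⟨⟨l₁, l₃, -⟩, -⟩ := ht
    exact ⟨_, .single (.letPair ((h₁.closed_iff l₁).2 hp) ((h₃.closed_iff l₃).2 hq)),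
      h₂.inst₂ h₁ h₃⟩
  | recZero hp hv hw =>
    obtain h | h := h.of_wHead_or_cong (.recZero hp hv hw)
    · exact ⟨u, .refl, h⟩
    obtain _ | _ | _ | ⟨g₁, h₂, h₃, h₄⟩ := h
    obtain _ | _ | _ | _ | _ | _ | ⟨g₅, h₅⟩ := g₁.cong_of_isValue (.pair _ _)
    obtain _ | _ := g₅.cong_of_isValue .zero
    obtain ⟨⟨⟨-, l₅, -⟩, -, l₃, l₄⟩, -⟩ := ht
    exact ⟨_, .single (.recZero ((h₅.closed_iff l₅).2 hp) ((h₃.closed_iff l₃).2 hv)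
      ((h₄.closed_iff l₄).2 hw)), h₂⟩
  | recSuc hv hw =>
    obtain h | h := h.of_wHead_or_cong (.recSuc hv hw)
    · exact ⟨u, .refl, h⟩
    obtain _ | _ | _ | ⟨g₁, h₂, h₃, h₄⟩ := h
    obtain _ | _ | _ | _ | _ | _ | ⟨g₅, h₅⟩ := g₁.cong_of_isValue (.pair _ _)
    obtain _ | _ | h₁ := g₅.cong_of_isValue (.suc _)
    obtain ⟨⟨-, -, l₃, l₄⟩, -⟩ := ht
    exact ⟨_, .single (.recSuc ((h₃.closed_iff l₃).2 hv) ((h₄.closed_iff l₄).2 hw)),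
      .app .refl h₃ (.recur .refl (.app .refl h₄ (.pair .refl h₁ h₅)) h₂ h₃ h₄)⟩
  | app w ih =>
    obtain h | h := h.of_wHead_or_cong (.app w)
    · exact ⟨u, .refl, h⟩
    obtain _ | _ | _ | _ | ⟨h₁, h₂⟩ := h
    obtain ⟨u₁, w₁, h₁⟩ := ih ht.1 h₁
    exact ⟨_, w₁.app, .app .refl h₁ h₂⟩
  | letp w ih =>
    obtain h | h := h.of_wHead_or_cong (.letp w)
    · exact ⟨u, .refl, h⟩
    obtain _ | _ | _ | _ | _ | _ | _ | ⟨h₁, h₂⟩ := h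
    obtain ⟨u₁, w₁, h₁⟩ := ih ht.1 h₁
    exact ⟨_, w₁.letp, .letp .refl h₁ h₂⟩
  | recur w ih =>
    obtain h | h := h.of_wHead_or_cong (.recur w)
    · exact ⟨u, .refl, h⟩
    obtain _ | _ | _ | ⟨h₁, h₂, h₃, h₄⟩ := h
    obtain ⟨u₁, w₁, h₁⟩ := ih ht.1.1 h₁
    exact ⟨_, w₁.recur, .recur .refl h₁ h₂ h₃ h₄⟩
  | recPair w ih =>
    obtain h | h := h.of_wHead_or_cong (.recPair w)
    · exact ⟨u, .refl, h⟩
    obtain _ | _ | _ | ⟨g₁, h₂, h₃, h₄⟩ := h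
    obtain _ | _ | _ | _ | _ | _ | ⟨h₁, h₅⟩ := g₁.cong_of_isValue (.pair _ _)
    obtain ⟨u₁, w₁, h₁⟩ := ih ht.1.1.1 h₁
    exact ⟨_, w₁.recPair, .recur .refl (.pair .refl h₁ h₅) h₂ h₃ h₄⟩

end Std

theorem Red.exists_wHeads_right {t u V : Tm} (h : Red t u) (ht : t.Linear) (w : WHeads t V)
    (hV : IsValue V) : ∃ V', WHeads u V' ∧ IsValue V' ∧ Red V V' := by
  replace h := Red.std h ht
  induction w using Relation.ReflTransGen.head_induction_on generalizing u with
  | refl => exact ⟨u, .refl, (h.cong_of_isValue hV).isValue_iff.1 hV, h.red⟩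
  | head w _ ih =>
    obtain ⟨u₁, w₁, h₁⟩ := h.exists_wHeads w ht
    obtain ⟨V', w', hV', r⟩ := ih (w.step.linear_occurs ht).1 h₁
    exact ⟨V', w₁.trans w', hV', r⟩

theorem Red.exists_wHeads_left {t u V : Tm} (h : Red t u) (ht : t.Linear) (w : WHeads u V)
    (hV : IsValue V) : ∃ V', WHeads t V' ∧ IsValue V' ∧ Red V' V := by
  obtain ⟨V', w', h⟩ := (Red.std (h.trans w.red) ht).exists_cong
  exact ⟨V', w', h.isValue_iff.2 hV, h.std.red⟩

/-- Having a weak head normal form is invariant under convertibility, and the weak head normal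
forms are convertible. -/
theorem Conv.exists_wHeads {t u V : Tm} (h : Conv t u) (w : WHeads t V) (hV : IsValue V) :
    ∃ V', WHeads u V' ∧ IsValue V' ∧ Conv V V' := by
  -- Both directions are proved at once, on account of the symmetry rule.
  let Lead (a b : Tm) : Prop := ∀ V, WHeads a V → IsValue V → ∃ V', WHeads b V' ∧ IsValue V' ∧
    Relation.EqvGen (fun a b : Tm => a.Linear ∧ b.Linear ∧ Step a b) V V'
  have trans : ∀ {a b c}, Lead a b → Lead b c → Lead a c := by
    intro a b c hab hbc V w hV
    obtain ⟨V₁, w₁, hV₁, c₁⟩ := hab V w hV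
    obtain ⟨V₂, w₂, hV₂, c₂⟩ := hbc V₁ w₁ hV₁
    exact ⟨V₂, w₂, hV₂, .trans _ _ _ c₁ c₂⟩
  obtain ⟨ht, hu, h⟩ := h
  suffices H : Lead t u ∧ Lead u t by
    obtain ⟨V', w', hV', c⟩ := H.1 V w hV
    exact ⟨V', w', hV', (w.red.linear_occurs ht).1, (w'.red.linear_occurs hu).1, c⟩
  clear w hV ht hu
  induction h with
  | rel a b h =>
    obtain ⟨ha, hb, h⟩ := h
    refine ⟨fun V w hV => ?_, fun V w hV => ?_⟩
    · obtain ⟨V', w', hV', r⟩ := Red.exists_wHeads_right (.single h) ha w hV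
      exact ⟨V', w', hV', (Red.conv r (w.red.linear_occurs ha).1).2.2⟩
    · obtain ⟨V', w', hV', r⟩ := Red.exists_wHeads_left (.single h) ha w hV
      exact ⟨V', w', hV', (Red.conv r (w'.red.linear_occurs ha).1).symm.2.2⟩
  | refl a =>
    exact ⟨fun V w hV => ⟨V, w, hV, .refl _⟩, fun V w hV => ⟨V, w, hV, .refl _⟩⟩
  | symm a b _ ih => exact ih.symm
  | trans a b c _ _ ih₁ ih₂ => exact ⟨trans ih₁.1 ih₂.1, trans ih₂.2 ih₁.2⟩

end Lrec

/-! ### Erasers and duplicators -/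

namespace Lrec

open Tm

namespace Tm

theorem closed_I : I.Closed := fun i => by simp [I, occurs]

theorem linear_I : I.Linear := by simp [I, Linear, occurs]

theorem occurs_erase_and_closed_make (A : Ty) :
    (∀ t i, occurs i (erase t A) = occurs i t) ∧ (make A).Closed := by
  induction A with
  | nat => exact ⟨fun t i => by simp [erase, occurs, closed_I i], fun i => rfl⟩
  | lolli A B ihA ihB =>
    exact ⟨fun t i => by simp [erase, ihB.1, occurs, ihA.2 i],
      fun i => by simp [make, occurs, ihA.1, ihB.2 (i + 1)]⟩
  | tensor A B ihA ihB =>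
    exact ⟨fun t i => by simp [erase, occurs, ihA.1, ihB.1],
      fun i => by simp [make, occurs, ihA.2 i, ihB.2 i]⟩

theorem occurs_erase (t : Tm) (A : Ty) (i : ℕ) : occurs i (erase t A) = occurs i t :=
  (occurs_erase_and_closed_make A).1 t i

theorem closed_make (A : Ty) : (make A).Closed := (occurs_erase_and_closed_make A).2

theorem linear_erase_and_linear_make (A : Ty) :
    (∀ t, t.Linear → (erase t A).Linear) ∧ (make A).Linear := by
  induction A with
  | nat =>
    refine ⟨fun t ht => ?_, trivial⟩
    simp [erase, Linear, ht, linear_I, FVDisjoint, occurs, closed_I _]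
  | lolli A B ihA ihB =>
    refine ⟨fun t ht => ihB.1 _ ⟨ht, ihA.2, (closed_make A).fvDisjoint_right _⟩,
      ⟨ihA.1 _ trivial, ihB.2, (closed_make B).fvDisjoint_right _⟩, ?_⟩
    simp [occurs, occurs_erase]
  | tensor A B ihA ihB =>
    refine ⟨fun t ht => ⟨ht, ⟨ihA.1 _ trivial, ihB.1 _ trivial, ?_⟩, ?_, ?_, ?_⟩,
      ihA.2, ihB.2, (closed_make A).fvDisjoint_left _⟩
    · intro i; simp [occurs, occurs_erase]; omega
    all_goals simp [occurs, occurs_erase]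

theorem linear_erase {t : Tm} (ht : t.Linear) (A : Ty) : (erase t A).Linear :=
  (linear_erase_and_linear_make A).1 t ht

theorem linear_make (A : Ty) : (make A).Linear := (linear_erase_and_linear_make A).2

theorem subst_erase (σ : ℕ → Tm) (t : Tm) (A : Ty) :
    subst σ (erase t A) = erase (subst σ t) A := by
  induction A generalizing t σ with
  | nat => simp [erase, subst, closed_I.subst_eq]
  | lolli A B ihA ihB => simp [erase, ihB, subst, (closed_make A).subst_eq]
  | tensor A B ihA ihB => simp [erase, subst, ihA, ihB, liftSub, rename]

end Tm

theorem Red.erase {t u : Tm} (h : Red t u) (A : Ty) : Red (erase t A) (erase u A) := by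
  induction A generalizing t u with
  | nat => exact .recur (.pair h .refl) .refl .refl .refl
  | lolli A B _ ihB => exact ihB (.app h .refl)
  | tensor A B _ _ => exact .letp h .refl

theorem red_I_app {t : Tm} (ht : t.Closed) : Red (app I t) t := .single (.beta ht)

/-- Only the canonical inhabitants are ever erased in earnest: `E(M(A), A)` is the identity. -/
theorem red_erase_make (A : Ty) : Red (erase (make A) A) I := by
  induction A with
  | nat => exact .single (.recZero (fun _ => rfl) closed_I closed_I)
  | lolli A B ihA ihB =>
    refine Relation.ReflTransGen.trans (Red.erase ?_ B) ihB
    have h : Step (app (make (.lolli A B)) (make A)) (app (Tm.erase (make A) A) (make B)) := by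
      have := Step.beta (t := app (Tm.erase (var 0) A) (make B)) (closed_make A)
      simpa only [make, inst, subst, subst_erase, consSub, (closed_make B).subst_eq] using this
    exact .head h (.trans (Red.app ihA .refl) (red_I_app (closed_make B)))
  | tensor A B ihA ihB =>
    have h : Step (Tm.erase (make (.tensor A B)) (.tensor A B))
        (app (Tm.erase (make A) A) (Tm.erase (make B) B)) := by
      have := Step.letPair (v := app (Tm.erase (var 1) A) (Tm.erase (var 0) B))
        (closed_make A) (closed_make B)
      simpa only [Tm.erase, make, inst₂, subst, subst_erase, consSub] using this
    exact .head h (.trans (Red.app ihA ihB) (red_I_app closed_I))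

/-- A recursor whose fourth argument is the identity unfolds like an iterator. -/
theorem red_recur_suc {n p u v : Tm} (hn : n.Closed) (hp : p.Closed) (hv : v.Closed) :
    Red (recur (pair (suc n) p) u v I) (app v (recur (pair n p) u v I)) :=
  .head (.recSuc hv closed_I) (Red.app .refl (Red.recur (red_I_app fun i => by
    simp [occurs, hn i, hp i]) .refl .refl .refl))

theorem red_recur_zero {p u v : Tm} (hp : p.Closed) (hv : v.Closed) :
    Red (recur (pair zero p) u v I) u := .single (.recZero hp hv closed_I)

namespace Tm

theorem closed_zero : zero.Closed := fun _ => rfl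

theorem Closed.pair {t u : Tm} (ht : t.Closed) (hu : u.Closed) : (pair t u).Closed :=
  fun i => by simp [occurs, ht i, hu i]

theorem Closed.recur {t u v w : Tm} (ht : t.Closed) (hu : u.Closed) (hv : v.Closed)
    (hw : w.Closed) : (recur t u v w).Closed :=
  fun i => by simp [occurs, ht i, hu i, hv i, hw i]

theorem closed_dup (A : Ty) : (dup A).Closed := by
  intro i
  simp [dup, occurs, occurs_erase, closed_make A _, closed_I _]

theorem linear_dup (A : Ty) : (dup A).Linear := by
  simp [dup, Linear, occurs, occurs_erase, linear_make, linear_erase (t := var 1) trivial, linear_I,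
    FVDisjoint, closed_make A _, closed_I _]

end Tm

/-- The duplicator builds its two copies in two iterations, each of which shifts a copy of the
argument into the pair and erases the canonical inhabitant that falls out. -/
theorem red_dup_app {t : Tm} (ht : t.Closed) (A : Ty) : Red (app (dup A) t) (pair t t) := by
  set F : Tm := lam (letp (var 0) (app (erase (var 1) A) (pair (var 0) t))) with hF
  have hFc : F.Closed := fun i => by simp [hF, occurs, occurs_erase, ht _]
  have shift : ∀ q : Tm, q.Closed → Red (app F (pair (make A) q)) (pair q t) := by
    intro q hq
    have h₁ : Step (app F (pair (make A) q))
        (letp (pair (make A) q) (app (erase (var 1) A) (pair (var 0) t))) := by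
      have := Step.beta (t := letp (var 0) (app (erase (var 1) A) (pair (var 0) t)))
        ((closed_make A).pair hq)
      simpa [inst, subst, subst_erase, consSub, liftSub, ht.subst_eq, rename] using this
    have h₂ : Step (letp (pair (make A) q) (app (erase (var 1) A) (pair (var 0) t)))
        (app (erase (make A) A) (pair q t)) := by
      have := Step.letPair (v := app (erase (var 1) A) (pair (var 0) t)) (closed_make A) hq
      simpa [inst₂, subst, subst_erase, consSub, ht.subst_eq] using this
    exact .head h₁ (.head h₂ (.trans (Red.app (red_erase_make A) .refl) (red_I_app (hq.pair ht))))
  have h : Step (app (dup A) t)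
      (recur (pair (suc (suc zero)) zero) (pair (make A) (make A)) F I) := by
    have := Step.beta (t := recur (pair (suc (suc zero)) zero) (pair (make A) (make A))
      (lam (letp (var 0) (app (erase (var 1) A) (pair (var 0) (var 3))))) I) ht
    simpa [dup, inst, subst, subst_erase, consSub, liftSub, ht.rename_eq, rename,
      (closed_make A).subst_eq, closed_I.subst_eq, hF] using this
  refine .head h (.trans (red_recur_suc closed_zero closed_zero hFc) ?_)
  refine .trans (Red.app .refl (red_recur_suc closed_zero closed_zero hFc)) ?_
  refine .trans (Red.app .refl (Red.app .refl (red_recur_zero closed_zero hFc))) ?_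
  exact .trans (Red.app .refl (shift _ (closed_make A))) (shift t ht)

/-! ### Linearization -/

namespace Tm

theorem linearize_of_occurs_eq_false (A : Ty) {i : ℕ} {t : Tm} (h : occurs i t = false) :
    linearize A i t = t := by
  induction t generalizing i with
  | app t u iht ihu =>
    simp only [occurs, Bool.or_eq_false_iff] at h
    simp [linearize, h.1, h.2, ihu h.2]
  | suc t ih => simp only [linearize, ih h]
  | lam t ih => simp only [linearize, ih h]
  | letp t u _ ih =>
    simp only [occurs, Bool.or_eq_false_iff] at h
    simp only [linearize, ih h.2]
  | _ => rfl

theorem occurs_linearize (A : Ty) (i : ℕ) (t : Tm) (j : ℕ) :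
    occurs j (linearize A i t) = occurs j t := by
  induction t generalizing i j with
  | app t u iht ihu =>
    simp only [linearize]
    split_ifs with h h'
    · rw [Bool.eq_iff_iff]
      simp only [occurs, Bool.or_eq_true, occurs_rename, iht, ihu, closed_dup A j]
      simp only [Bool.and_eq_true] at h
      rcases eq_or_ne j i with rfl | hj
      · simp [h]
      · have : ∀ (P : ℕ → Prop) (c : ℕ), c < 2 →
            ((∃ k, P k ∧ j + 2 = if k = i then c else k + 2) ↔ P j) := by
          intro P c hc
          constructor
          · rintro ⟨k, hk, e⟩
            split_ifs at e with hki
            · omega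
            · rwa [show j = k by omega]
          · exact fun hk => ⟨j, hk, by simp [hj]⟩
        simp [hj, this]
    · simp [occurs, iht]
    · simp [occurs, ihu]
  | suc t ih => simp only [linearize, occurs, ih]
  | lam t ih => simp only [linearize, occurs, ih]
  | letp t u _ ih => simp only [linearize, occurs, ih]
  | _ => rfl

/-- Linearization commutes with the substitutions that rename the variable in question and keep
it apart from the other variables. -/
theorem linearize_subst (A : Ty) {σ : ℕ → Tm} {i i' : ℕ} (hi : σ i = var i')
    (hσ : ∀ j, j ≠ i → occurs i' (σ j) = false) (t : Tm) :
    linearize A i' (subst σ t) = subst σ (linearize A i t) := by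
  have lift : ∀ {σ : ℕ → Tm} {i i' : ℕ},
      (σ i = var i' ∧ ∀ j, j ≠ i → occurs i' (σ j) = false) →
      liftSub σ (i + 1) = var (i' + 1) ∧
        ∀ j, j ≠ i + 1 → occurs (i' + 1) (liftSub σ j) = false := by
    rintro σ i i' ⟨hi, hσ⟩
    refine ⟨by simp [liftSub, hi, rename], ?_⟩
    rintro (_ | j) hj
    · simp [liftSub, occurs]
    · rw [liftSub, occurs_succ_rename_succ]
      exact hσ j (by omega)
  have occ : ∀ {σ : ℕ → Tm} {i i' : ℕ}, σ i = var i' →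
      (∀ j, j ≠ i → occurs i' (σ j) = false) → ∀ t, occurs i' (subst σ t) = occurs i t := by
    intro σ i i' hi hσ t
    rw [Bool.eq_iff_iff, occurs_subst]
    constructor
    · rintro ⟨j, hj, e⟩
      by_cases h : j = i
      · rwa [← h]
      · simp [hσ j h] at e
    · exact fun h => ⟨i, h, by simp [hi, occurs]⟩
  induction t generalizing σ i i' with
  | var j =>
    by_cases h : j = i
    · subst h; simp [subst, linearize, hi]
    · simp [subst, linearize, linearize_of_occurs_eq_false A (hσ j h)]
  | app t u iht ihu =>
    simp only [subst, linearize, occ hi hσ]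
    have key : ∀ (c : ℕ) (s : Tm), c < 2 →
        rename (fun j => if j = i' then c else j + 2) (subst σ s) =
          subst (liftSub (liftSub σ)) (rename (fun j => if j = i then c else j + 2) s) := by
      intro c s hc
      rw [rename_subst, subst_rename]
      refine subst_congr fun j _ => ?_
      by_cases h : j = i
      · subst h
        interval_cases c <;> simp [hi, rename, liftSub]
      · simp only [h, if_false, liftSub, rename_eq_subst, subst_subst]
        refine subst_congr fun k hk => ?_
        have : k ≠ i' := by rintro rfl; simp [hσ j h] at hk
        simp [this, subst]
    split_ifs
    · simp only [subst, hi, (closed_dup A).subst_eq, iht hi hσ, ihu hi hσ,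
        key _ _ one_lt_two, key _ _ two_pos]
    · simp only [subst, iht hi hσ]
    · simp only [subst, ihu hi hσ]
  | suc t ih => simp only [subst, linearize, ih hi hσ]
  | lam t ih =>
    have l := lift ⟨hi, hσ⟩
    simp only [subst, linearize, ih l.1 l.2]
  | letp t u _ ih =>
    have l := lift (lift ⟨hi, hσ⟩)
    simp only [subst, linearize, ih l.1 l.2]
  | _ => rfl

end Tm

/-- Linearization is undone by the substitution of a closed term, which the duplicators that have
been put in copy wherever it is needed. -/
theorem red_subst_linearize (A : Ty) {σ : ℕ → Tm} {i : ℕ} (hi : (σ i).Closed) (t : Tm) :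
    Red (subst σ (linearize A i t)) (subst σ t) := by
  have lift : ∀ {σ : ℕ → Tm} {i : ℕ}, (σ i).Closed → (liftSub σ (i + 1)).Closed := by
    intro σ i h
    rwa [liftSub, h.rename_eq]
  induction t generalizing σ i with
  | app t u iht ihu =>
    simp only [linearize]
    split_ifs with h h'
    · refine .trans (Red.letp (by rw [Tm.subst, (closed_dup A).subst_eq]; exact red_dup_app hi A)
        .refl) (.head (.letPair hi hi) ?_)
      have key : ∀ (c : ℕ) (s : Tm), c < 2 →
          subst (consSub (σ i) (consSub (σ i) var)) (subst (liftSub (liftSub σ))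
            (rename (fun j => if j = i then c else j + 2) s)) = subst σ s := by
        intro c s hc
        rw [subst_subst, subst_rename]
        refine subst_congr fun j _ => ?_
        by_cases h : j = i
        · subst h
          interval_cases c <;> simp [liftSub, rename, subst, consSub]
        · simp [h, liftSub, subst_rename, consSub, subst_var]
      simp only [inst₂, Tm.subst, key _ _ one_lt_two, key _ _ two_pos]
      exact Red.app (iht hi) (ihu hi)
    · exact .app (iht hi) .refl
    · exact .app .refl (ihu hi)
  | suc t ih => exact .suc (ih hi)
  | lam t ih => exact .lam (ih (lift hi))
  | letp t u _ ih => exact .letp .refl (ih (lift (lift hi)))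
  | _ => exact .refl

namespace Tm

/-- The image of a set of variables under one binder. -/
def shiftSet (S : Set ℕ) : Set ℕ := Nat.succ '' S

/-- The term is linear up to the multiplicity of the variables in `S`. These may be shared by the
two parts of an application; they are absent from the subterms that linearization does not
enter, namely recursors, pairs and the terms that a `let` takes apart. -/
def LinearOff : Set ℕ → Tm → Prop
  | _, var _ => True
  | _, zero => True
  | S, suc t => LinearOff S t
  | S, recur t u v w => (recur t u v w).Linear ∧ ∀ i ∈ S, occurs i (recur t u v w) = false
  | S, app t u => LinearOff S t ∧ LinearOff S u ∧
      ∀ i ∉ S, ¬ (occurs i t = true ∧ occurs i u = true)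
  | S, lam t => LinearOff (shiftSet S) t ∧ occurs 0 t = true
  | S, pair t u => (pair t u).Linear ∧ ∀ i ∈ S, occurs i (pair t u) = false
  | S, letp t u => (t.Linear ∧ ∀ i ∈ S, occurs i t = false) ∧
      LinearOff (shiftSet (shiftSet S)) u ∧ occurs 0 u = true ∧ occurs 1 u = true ∧
      ∀ i, ¬ (occurs i t = true ∧ occurs (i + 2) u = true)

theorem zero_notMem_shiftSet (S : Set ℕ) : 0 ∉ shiftSet S := by simp [shiftSet]

theorem succ_mem_shiftSet {S : Set ℕ} {i : ℕ} : i + 1 ∈ shiftSet S ↔ i ∈ S := by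
  simp [shiftSet]

theorem LinearOff.congr {S T : Set ℕ} {t : Tm} (h : LinearOff S t)
    (hST : ∀ i, occurs i t = true → (i ∈ S ↔ i ∈ T)) : LinearOff T t := by
  have lift : ∀ {S T : Set ℕ} {P : ℕ → Prop}, (∀ i, P (i + 1) → (i ∈ S ↔ i ∈ T)) →
      ∀ i, P i → (i ∈ shiftSet S ↔ i ∈ shiftSet T) := by
    rintro S T P h (_ | i) hi
    · simp [zero_notMem_shiftSet]
    · simpa only [succ_mem_shiftSet] using h i hi
  have absent : ∀ {S T : Set ℕ} {t : Tm}, (∀ i ∈ S, occurs i t = false) →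
      (∀ i, occurs i t = true → (i ∈ S ↔ i ∈ T)) → ∀ i ∈ T, occurs i t = false := by
    intro S T t h hST i hi
    by_contra hc
    rw [Bool.not_eq_false] at hc
    simp [h i ((hST i hc).2 hi)] at hc
  induction t generalizing S T with
  | var j => trivial
  | zero => trivial
  | suc t ih => exact ih h hST
  | recur t u v w => exact ⟨h.1, absent h.2 hST⟩
  | pair t u => exact ⟨h.1, absent h.2 hST⟩
  | app t u iht ihu =>
    simp only [occurs, Bool.or_eq_true] at hST
    exact ⟨iht h.1 fun i hi => hST i (.inl hi), ihu h.2.1 fun i hi => hST i (.inr hi),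
      fun i hi hc => h.2.2 i (fun hS => hi ((hST i (.inl hc.1)).1 hS)) hc⟩
  | lam t ih => exact ⟨ih h.1 (lift hST), h.2⟩
  | letp t u iht ihu =>
    simp only [occurs, Bool.or_eq_true] at hST
    obtain ⟨⟨h₁, h₂⟩, h₃, h₄⟩ := h
    exact ⟨⟨h₁, absent h₂ fun i hi => hST i (.inl hi)⟩,
      ihu h₃ (lift (P := fun i => occurs i u = true)
        (lift (P := fun i => occurs (i + 1) u = true) fun i hi => hST i (.inr hi))), h₄⟩

theorem shiftSet_empty : shiftSet ∅ = ∅ := by simp [shiftSet]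

theorem linearOff_empty_iff {t : Tm} : LinearOff ∅ t ↔ t.Linear := by
  induction t <;> simp_all [LinearOff, Linear, shiftSet_empty, FVDisjoint]

theorem Linear.linearOff {S : Set ℕ} {t : Tm} (h : t.Linear)
    (hS : ∀ i ∈ S, occurs i t = false) : LinearOff S t :=
  (linearOff_empty_iff.2 h).congr fun i hi => by
    simp only [Set.mem_empty_iff_false, false_iff]
    intro hiS
    simp [hS i hiS] at hi

theorem LinearOff.rename {S T : Set ℕ} {ρ : ℕ → ℕ} (hρ : Function.Injective ρ)
    (hST : ∀ i, ρ i ∈ T ↔ i ∈ S) {t : Tm} (h : LinearOff S t) : LinearOff T (rename ρ t) := by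
  have lift : ∀ {S T : Set ℕ} {ρ : ℕ → ℕ},
      (Function.Injective ρ ∧ ∀ i, ρ i ∈ T ↔ i ∈ S) →
      Function.Injective (liftRen ρ) ∧ ∀ i, liftRen ρ i ∈ shiftSet T ↔ i ∈ shiftSet S := by
    rintro S T ρ ⟨hρ, hST⟩
    refine ⟨fun i j h => ?_, ?_⟩
    · cases i <;> cases j <;> simp_all [liftRen, hρ.eq_iff]
    · rintro (_ | i)
      · simp [liftRen, zero_notMem_shiftSet]
      · simp [liftRen, succ_mem_shiftSet, hST]
  have absent : ∀ {S T : Set ℕ} {ρ : ℕ → ℕ} {t : Tm}, (∀ i, ρ i ∈ T ↔ i ∈ S) →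
      (∀ i ∈ S, occurs i t = false) → ∀ i ∈ T, occurs i (Tm.rename ρ t) = false := by
    intro S T ρ t hST h i hi
    rw [Bool.eq_false_iff, Ne, occurs_rename]
    rintro ⟨j, hj, rfl⟩
    simp [h j ((hST j).1 hi)] at hj
  have both : ∀ {ρ : ℕ → ℕ} {t u : Tm} {i : ℕ}, Function.Injective ρ →
      occurs i (Tm.rename ρ t) = true ∧ occurs i (Tm.rename ρ u) = true →
      ∃ j, i = ρ j ∧ occurs j t = true ∧ occurs j u = true := by
    rintro ρ t u i hρ ⟨h₁, h₂⟩
    obtain ⟨j, hj, rfl⟩ := (occurs_rename _ _ _).1 h₁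
    obtain ⟨k, hk, e⟩ := (occurs_rename _ _ _).1 h₂
    exact ⟨j, rfl, hj, by rwa [hρ e]⟩
  induction t generalizing S T ρ with
  | var j => trivial
  | zero => trivial
  | suc t ih => exact ih hρ hST h
  | recur t u v w => exact ⟨linear_rename hρ h.1, absent hST h.2⟩
  | pair t u => exact ⟨linear_rename hρ h.1, absent hST h.2⟩
  | app t u iht ihu =>
    refine ⟨iht hρ hST h.1, ihu hρ hST h.2.1, fun i hi hc => ?_⟩
    obtain ⟨j, rfl, hj⟩ := both hρ hc
    exact h.2.2 j (fun hS => hi ((hST j).2 hS)) hj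
  | lam t ih =>
    have l := lift ⟨hρ, hST⟩
    exact ⟨ih l.1 l.2 h.1, (occurs_rename _ _ _).2 ⟨0, h.2, rfl⟩⟩
  | letp t u iht ihu =>
    obtain ⟨⟨h₁, h₂⟩, h₃, o₀, o₁, d⟩ := h
    have l := lift (lift ⟨hρ, hST⟩)
    refine ⟨⟨linear_rename hρ h₁, absent hST h₂⟩, ihu l.1 l.2 h₃,
      (occurs_rename _ _ _).2 ⟨0, o₀, rfl⟩, (occurs_rename _ _ _).2 ⟨1, o₁, rfl⟩, ?_⟩
    rintro i ⟨h₁, h₂⟩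
    obtain ⟨j, hj, rfl⟩ := (occurs_rename _ _ _).1 h₁
    obtain ⟨_ | _ | k, hk, e⟩ := (occurs_rename _ _ _).1 h₂
    · simp [liftRen] at e
    · simp [liftRen] at e
    · have e : ρ j = ρ k := by simpa [liftRen] using e
      exact d j ⟨hj, by rwa [hρ e]⟩

/-- Linearizing a variable makes it linear. -/
theorem LinearOff.linearize (A : Ty) {S : Set ℕ} {i : ℕ} {t : Tm} (h : LinearOff S t)
    (hi : i ∈ S) (ho : occurs i t = true) : LinearOff (S \ {i}) (linearize A i t) := by
  have lift : ∀ (S : Set ℕ) (i : ℕ), shiftSet (S \ {i}) = shiftSet S \ {i + 1} := by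
    intro S i
    simp [shiftSet, Set.image_sdiff Nat.succ_injective]
  induction t generalizing S i with
  | var j => trivial
  | zero => trivial
  | suc t ih => exact ih h hi ho
  | recur t u v w => simp [h.2 i hi] at ho
  | pair t u => simp [h.2 i hi] at ho
  | app t u iht ihu =>
    obtain ⟨ht, hu, d⟩ := h
    have same : ∀ s, occurs i s = false → LinearOff S s → LinearOff (S \ {i}) s :=
      fun s hs h => h.congr fun j hj => by
        have : j ≠ i := by rintro rfl; simp [hs] at hj
        simp [this]
    simp only [Tm.linearize]
    split_ifs with h₁ h₂
    · simp only [Bool.and_eq_true] at h₁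
      have inj : ∀ c, c < 2 → Function.Injective fun j : ℕ => if j = i then c else j + 2 := by
        intro c hc j k h
        dsimp only at h
        split_ifs at h <;> omega
      have mem : ∀ c, c < 2 → ∀ j : ℕ, (if j = i then c else j + 2) ∈
          shiftSet (shiftSet (S \ {i})) ↔ j ∈ S \ {i} := by
        intro c hc j
        split_ifs with h
        · interval_cases c <;> simp [h, shiftSet]
        · simp only [succ_mem_shiftSet]
      refine ⟨⟨⟨linear_dup A, trivial, (closed_dup A).fvDisjoint_left _⟩, ?_⟩,
        ⟨(iht ht hi h₁.1).rename (inj _ one_lt_two) (mem _ one_lt_two),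
          (ihu hu hi h₁.2).rename (inj _ two_pos) (mem _ two_pos), ?_⟩, ?_, ?_, ?_⟩
      · rintro j ⟨-, hj⟩
        simp only [occurs, closed_dup A j, Bool.false_or, beq_eq_false_iff_ne]
        exact hj
      · rintro j hj ⟨h₃, h₄⟩
        obtain ⟨k, hk, rfl⟩ := (occurs_rename _ _ _).1 h₃
        obtain ⟨l, hl, e⟩ := (occurs_rename _ _ _).1 h₄
        rw [mem _ one_lt_two] at hj
        rw [occurs_linearize] at hk hl
        obtain ⟨hki, rfl⟩ : k ≠ i ∧ k = l := by split_ifs at e <;> omega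
        exact d k (fun hS => hj ⟨hS, hki⟩) ⟨hk, hl⟩
      · simp only [occurs, Bool.or_eq_true, occurs_rename, occurs_linearize]
        exact .inr ⟨i, h₁.2, by simp⟩
      · simp only [occurs, Bool.or_eq_true, occurs_rename, occurs_linearize]
        exact .inl ⟨i, h₁.1, by simp⟩
      · rintro j ⟨h₃, h₄⟩
        simp only [occurs, closed_dup A j, Bool.false_or, beq_iff_eq] at h₃
        subst h₃
        simp only [occurs, Bool.or_eq_true, occurs_rename, occurs_linearize] at h₄
        obtain ⟨k, -, e⟩ | ⟨k, -, e⟩ := h₄ <;> split_ifs at e <;> omega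
    · have h₃ : occurs i u = false := by simpa [h₂] using h₁
      refine ⟨iht ht hi h₂, same u h₃ hu, fun j hj hc => ?_⟩
      rw [occurs_linearize] at hc
      by_cases hji : j = i
      · subst hji; simp [h₃] at hc
      · exact d j (fun hS => hj ⟨hS, hji⟩) hc
    · rw [Bool.not_eq_true] at h₂
      have h₃ : occurs i u = true := by simpa [occurs, h₂] using ho
      refine ⟨same t h₂ ht, ihu hu hi h₃, fun j hj hc => ?_⟩
      rw [occurs_linearize] at hc
      by_cases hji : j = i
      · subst hji; simp [h₂] at hc
      · exact d j (fun hS => hj ⟨hS, hji⟩) hc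
  | lam t ih =>
    exact ⟨by rw [lift]; exact ih h.1 (succ_mem_shiftSet.2 hi) ho,
      by rw [occurs_linearize]; exact h.2⟩
  | letp t u iht ihu =>
    obtain ⟨⟨h₁, h₂⟩, h₃, o₀, o₁, d⟩ := h
    have ho : occurs (i + 2) u = true := by simpa [occurs, h₂ i hi] using ho
    refine ⟨⟨h₁, fun j hj => h₂ j hj.1⟩, ?_, by rwa [occurs_linearize],
      by rwa [occurs_linearize], by simpa only [occurs_linearize] using d⟩
    rw [lift, lift]
    exact ihu h₃ (succ_mem_shiftSet.2 (succ_mem_shiftSet.2 hi)) ho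

end Tm

end Lrec

/-! ### The compiled constants -/

namespace Lrec

open Tm

namespace Tm

theorem closed_num (n : ℕ) : (num n).Closed := by
  induction n with
  | zero => exact closed_zero
  | succ n ih => exact ih

theorem linear_num (n : ℕ) : (num n).Linear := by
  induction n with
  | zero => trivial
  | succ n ih => exact ih

theorem closed_fst : fst.Closed := fun i => by simp [fst, occurs, closed_I _]

theorem linear_fst : fst.Linear := by
  simp [fst, Linear, occurs, linear_I, FVDisjoint, closed_I _]

theorem closed_snd : snd.Closed := fun i => by simp [snd, occurs, closed_I _]

theorem linear_snd : snd.Linear := by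
  simp [snd, Linear, occurs, linear_I, FVDisjoint, closed_I _]

end Tm

theorem red_discard_num (n : ℕ) {a : Tm} (ha : a.Closed) :
    Red (recur (pair (num n) zero) a I I) a := by
  induction n with
  | zero => exact red_recur_zero closed_zero closed_I
  | succ n ih =>
    exact .trans (red_recur_suc (closed_num n) closed_zero closed_I)
      (.trans (Red.app .refl ih) (red_I_app ha))

theorem red_fst {a : Tm} (ha : a.Closed) (n : ℕ) : Red (app fst (pair a (num n))) a := by
  have hn := closed_num n
  have h₁ := Step.beta (t := letp (var 0) (recur (pair (var 0) zero) (var 1) I I)) (ha.pair hn)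
  have h₂ := Step.letPair (v := recur (pair (var 0) zero) (var 1) I I) ha hn
  refine .head h₁ (.head (b := recur (pair (num n) zero) a I I) ?_ (red_discard_num n ha))
  simpa [inst, inst₂, subst, consSub, liftSub, rename, closed_I.subst_eq] using h₂

theorem red_snd {b : Tm} (hb : b.Closed) (n : ℕ) : Red (app snd (pair (num n) b)) b := by
  have hn := closed_num n
  have h₁ := Step.beta (t := letp (var 0) (recur (pair (var 1) zero) (var 0) I I)) (hn.pair hb)
  have h₂ := Step.letPair (v := recur (pair (var 1) zero) (var 0) I I) hn hb
  refine .head h₁ (.head (b := recur (pair (num n) zero) b I I) ?_ (red_discard_num n hb))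
  simpa [inst, inst₂, subst, consSub, liftSub, rename, closed_I.subst_eq] using h₂

end Lrec

namespace PCF

open Lrec Lrec.Tm

theorem closed_compileSucc : compileSucc.Closed :=
  fun i => by simp [compileSucc, occurs, closed_I _]

theorem linear_compileSucc : compileSucc.Linear := by
  simp [compileSucc, Linear, occurs, linear_I, FVDisjoint, closed_I _]

theorem closed_compilePred : compilePred.Closed :=
  fun i => by simp [compilePred, occurs, closed_I _, closed_fst _, closed_snd _, closed_dup _ _]

theorem linear_compilePred : compilePred.Linear := by
  simp [compilePred, Linear, occurs, linear_I, linear_fst, linear_snd, linear_dup, FVDisjoint,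
    closed_I _, closed_fst _, closed_snd _, closed_dup _ _]

theorem closed_compileIszero : compileIszero.Closed :=
  fun i => by simp [compileIszero, occurs, closed_I _, closed_fst _, closed_snd _, closed_dup _ _]

theorem linear_compileIszero : compileIszero.Linear := by
  simp [compileIszero, Linear, occurs, linear_I, linear_fst, linear_snd, linear_dup, FVDisjoint,
    closed_I _, closed_fst _, closed_snd _, closed_dup _ _]

theorem closed_compileFix (A : Lrec.Ty) : (compileFix A).Closed :=
  fun i => by simp [compileFix, occurs, closed_make _ _]

theorem linear_compileFix (A : Lrec.Ty) : (compileFix A).Linear := by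
  simp [compileFix, Linear, occurs, linear_make, FVDisjoint, closed_make _ _]

theorem closed_compileCond (A : Lrec.Ty) : (compileCond A).Closed :=
  fun i => by simp [compileCond, occurs, closed_I _, occurs_erase]

theorem linear_compileCond (A : Lrec.Ty) : (compileCond A).Linear := by
  simp [compileCond, Linear, occurs, linear_I, linear_erase (t := var 0) trivial, FVDisjoint,
    closed_I _, occurs_erase]

theorem red_compileSucc (n : ℕ) : Red (app compileSucc (num n)) (num (n + 1)) := by
  have h := Step.beta (t := recur (pair (var 0) zero) (suc zero) (lam (suc (var 0))) I)
    (closed_num n)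
  have hc : (lam (suc (var 0))).Closed := fun i => by simp [occurs]
  have iter : ∀ n, Red (recur (pair (num n) zero) (suc zero) (lam (suc (var 0))) I)
      (num (n + 1)) := by
    intro n
    induction n with
    | zero => exact red_recur_zero closed_zero hc
    | succ n ih =>
      exact .trans (red_recur_suc (closed_num n) closed_zero hc)
        (.tail (Red.app .refl ih) (.beta (closed_num (n + 1))))
  refine .head ?_ (iter n)
  simp only [inst, subst, consSub, liftSub, closed_I.subst_eq] at h
  exact h

theorem red_compilePred (n : ℕ) : Red (app compilePred (num n)) (num (n - 1)) := by
  set G : Lrec.Tm := lam (letp (app (dup .nat) (app snd (var 0))) (pair (var 1) (suc (var 0))))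
    with hG
  have hGc : G.Closed := fun i => by simp [hG, occurs, closed_snd _, closed_dup _ _]
  have h := Step.beta (t := app fst (recur (pair (var 0) zero) (pair zero zero) G I))
    (closed_num n)
  -- The pair of the predecessor of `n` and `n` itself is computed by iteration.
  have step : ∀ m n, Red (app G (pair (num m) (num n))) (pair (num n) (num (n + 1))) := by
    intro m n
    have hm := closed_num m
    have hn := closed_num n
    have h₁ : Step (app G (pair (num m) (num n))) (letp (app (dup .nat)
        (app snd (pair (num m) (num n)))) (pair (var 1) (suc (var 0)))) := by
      have := Step.beta (t := letp (app (dup .nat) (app snd (var 0))) (pair (var 1) (suc (var 0))))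
        (hm.pair hn)
      simpa [hG, inst, subst, consSub, liftSub, rename, closed_snd.subst_eq,
        (closed_dup _).subst_eq] using this
    have h₂ := (Red.app .refl (red_snd hn m)).trans (red_dup_app hn .nat)
    exact .head h₁ (.tail (Red.letp h₂ .refl) (.letPair hn hn))
  have iter : ∀ n, Red (recur (pair (num n) zero) (pair zero zero) G I)
      (pair (num (n - 1)) (num n)) := by
    intro n
    induction n with
    | zero => exact red_recur_zero closed_zero hGc
    | succ n ih =>
      exact .trans (red_recur_suc (closed_num n) closed_zero hGc)
        (.trans (Red.app .refl ih) (step _ n))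
  refine .head (b := app fst (recur (pair (num n) zero) (pair zero zero) G I)) ?_
    (.trans (Red.app .refl (iter n)) (red_fst (closed_num _) n))
  simp only [inst, subst, consSub, closed_fst.subst_eq, hGc.subst_eq, closed_I.subst_eq] at h
  exact h

theorem red_compileIszero (n : ℕ) :
    Red (app compileIszero (num n)) (num (if n = 0 then 0 else 1)) := by
  set G : Lrec.Tm := lam (app (dup .nat) (app snd (var 0))) with hG
  have hGc : G.Closed := fun i => by simp [hG, occurs, closed_snd _, closed_dup _ _]
  have h := Step.beta (t := app fst (recur (pair (var 0) zero) (pair zero (suc zero)) G I))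
    (closed_num n)
  have step : ∀ m n, Red (app G (pair (num m) (num n))) (pair (num n) (num n)) := by
    intro m n
    have hm := closed_num m
    have hn := closed_num n
    have h₁ : Step (app G (pair (num m) (num n)))
        (app (dup .nat) (app snd (pair (num m) (num n)))) := by
      have := Step.beta (t := app (dup .nat) (app snd (var 0))) (hm.pair hn)
      simpa [inst, subst, consSub, closed_snd.subst_eq, (closed_dup _).subst_eq] using this
    exact .head h₁ ((Red.app .refl (red_snd hn m)).trans (red_dup_app hn .nat))
  have iter : ∀ n, Red (recur (pair (num n) zero) (pair zero (suc zero)) G I)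
      (pair (num (if n = 0 then 0 else 1)) (num 1)) := by
    intro n
    induction n with
    | zero => exact red_recur_zero closed_zero hGc
    | succ n ih =>
      exact .trans (red_recur_suc (closed_num n) closed_zero hGc)
        (.trans (Red.app .refl ih) (step _ 1))
  refine .head (b := app fst (recur (pair (num n) zero) (pair zero (suc zero)) G I)) ?_
    (.trans (Red.app .refl (iter n)) (red_fst (closed_num _) 1))
  simp only [inst, subst, consSub, closed_fst.subst_eq, hGc.subst_eq, closed_I.subst_eq] at h
  exact h

theorem red_compileCond (A : Lrec.Ty) {t u v : Lrec.Tm} (ht : t.Closed) (hu : u.Closed)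
    (hv : v.Closed) : Red (app (app (app (compileCond A) t) u) v)
      (recur (pair t zero) u (lam (app (recur (pair zero zero) I (erase (var 0) A) I) v)) I) := by
  refine .head (.app₁ (.app₁ (.beta ht))) (.head (.app₁ (.beta hu)) (.head (.beta hv) ?_))
  simp [inst, subst, consSub, liftSub, ht.rename_eq, hu.rename_eq, hv.rename_eq, ht.subst_eq,
    hu.subst_eq, rename, subst_erase, closed_I.subst_eq]
  exact .refl

theorem closed_condBranch (A : Lrec.Ty) {v : Lrec.Tm} (hv : v.Closed) :
    (lam (app (recur (pair zero zero) I (erase (var 0) A) I) v)).Closed :=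
  fun i => by simp [occurs, hv _, occurs_erase, closed_I _]

theorem red_compileCond_zero (A : Lrec.Ty) {u v : Lrec.Tm} (hu : u.Closed) (hv : v.Closed) :
    Red (app (app (app (compileCond A) (num 0)) u) v) u :=
  .trans (red_compileCond A (closed_num 0) hu hv)
    (red_recur_zero closed_zero (closed_condBranch A hv))

theorem red_compileCond_succ (A : Lrec.Ty) (n : ℕ) {u v : Lrec.Tm} (hu : u.Closed)
    (hv : v.Closed) : Red (app (app (app (compileCond A) (num (n + 1))) u) v) v := by
  refine .trans (red_compileCond A (closed_num (n + 1)) hu hv)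
    (.trans (red_recur_suc (closed_num n) closed_zero (closed_condBranch A hv)) ?_)
  set r := recur (pair (num n) zero) u
    (lam (app (recur (pair zero zero) I (erase (var 0) A) I) v)) I with hr
  have hrc : r.Closed :=
    ((closed_num n).pair closed_zero).recur hu (closed_condBranch A hv) closed_I
  have h : Step (app (lam (app (recur (pair zero zero) I (erase (var 0) A) I) v)) r)
      (app (recur (pair zero zero) I (erase r A) I) v) := by
    have := Step.beta (t := app (recur (pair zero zero) I (erase (var 0) A) I) v) hrc
    simpa [inst, subst, consSub, subst_erase, closed_I.subst_eq, hv.subst_eq] using this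
  exact .head h (.trans (Red.app (red_recur_zero closed_zero
    fun i => by rw [occurs_erase, hrc i]) .refl) (red_I_app hv))

/-- `⟦Y_A⟧ f` and `f (⟦Y_A⟧ f)` have a common reduct: the recursor restores the counter that it has
consumed, and hence never ends. -/
theorem exists_red_compileFix (A : Lrec.Ty) {f : Lrec.Tm} (hf : f.Closed) :
    ∃ r, Red (app (compileFix A) f) r ∧ Red (app f (app (compileFix A) f)) r := by
  set W : Lrec.Tm := lam (letp (var 0) (pair (suc (var 1)) (var 0))) with hW
  have hWc : W.Closed := fun i => by simp [hW, occurs]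
  set R : Lrec.Tm := recur (pair (suc zero) zero) (make A) f W with hR
  have h : Red (app (compileFix A) f) R := by
    have := Step.beta (t := recur (pair (suc zero) zero) (make A) (var 0) W) hf
    refine .single ?_
    simp only [inst, subst, consSub, hWc.subst_eq, (closed_make A).subst_eq] at this
    exact this
  have hw : Red (app W (pair zero zero)) (pair (suc zero) zero) :=
    .head (.beta (closed_zero.pair closed_zero)) (.single (.letPair closed_zero closed_zero))
  exact ⟨app f R, h.tail (.recSuc hf hWc) |>.trans (Red.app .refl (Red.recur hw .refl .refl .refl)),
    Red.app .refl h⟩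

/-! ### The compilation of terms -/

/-- The compilation of an abstraction, as a function of the compiled body `s`: `A` is the type of
the argument and `B` that of the result. -/
def compileLam (A B : Lrec.Ty) (s : Lrec.Tm) : Lrec.Tm :=
  if s.occurs 0 then lam (linearize A 0 s)
  else lam (app (recur (pair zero zero) I
    (lam (erase (app (erase (var 0) (.lolli B B)) (var 1)) A)) I) s)

theorem occurs_compileLam (A B : Lrec.Ty) (s : Lrec.Tm) (i : ℕ) :
    (compileLam A B s).occurs i = s.occurs (i + 1) := by
  unfold compileLam
  split_ifs <;> simp [occurs, occurs_linearize, occurs_erase, closed_I _]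

theorem subst_compileLam (A B : Lrec.Ty) (σ : ℕ → Lrec.Tm) (s : Lrec.Tm) :
    subst σ (compileLam A B s) = compileLam A B (subst (liftSub σ) s) := by
  simp only [compileLam, occurs_zero_subst_liftSub]
  split_ifs
  · rw [linearize_subst A (σ := liftSub σ) (i := 0) (i' := 0) rfl]
    · rfl
    · intro j hj
      rw [Bool.eq_false_iff, Ne, occurs_zero_liftSub]
      exact hj
  · simp [subst, subst_erase, closed_I.subst_eq, liftSub, rename]

theorem Tm.occurs_compile {Γ : Ctx} {A : Ty} (t : Tm Γ A) (i : ℕ) :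
    t.compile.occurs i = t.occurs i := by
  induction t generalizing i with
  | var x => rfl
  | @lam Γ A B t ih =>
    have : (Tm.lam t).compile = compileLam A.compile B.compile t.compile := by
      simp [Tm.compile, compileLam, ih]
    rw [this, occurs_compileLam, ih]
    rfl
  | app t u iht ihu => simp [Tm.compile, Lrec.Tm.occurs, Tm.occurs, iht, ihu]
  | num n => exact closed_num n i
  | succ => exact closed_compileSucc i
  | pred => exact closed_compilePred i
  | iszero => exact closed_compileIszero i
  | cond A => exact closed_compileCond _ i
  | fix A => exact closed_compileFix _ i

theorem Tm.compile_lam {Γ : Ctx} {A B : Ty} (t : Tm (A :: Γ) B) :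
    (Tm.lam t).compile = compileLam A.compile B.compile t.compile := by
  simp [Tm.compile, compileLam, Tm.occurs_compile]

theorem Tm.compile_rename {Γ Δ : Ctx} {A : Ty} (t : Tm Γ A) {ρ : ∀ A, Var Γ A → Var Δ A}
    {r : ℕ → ℕ} (h : ∀ A (x : Var Γ A), (ρ A x).toNat = r x.toNat) :
    (t.rename ρ).compile = t.compile.rename r := by
  induction t generalizing Δ r with
  | var x => simp [Tm.rename, Tm.compile, Lrec.Tm.rename, h]
  | lam t ih =>
    rw [Tm.rename, Tm.compile_lam, Tm.compile_lam, rename_eq_subst, subst_compileLam,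
      liftSub_var_comp, ← rename_eq_subst]
    congr 1
    refine ih fun A x => ?_
    cases x with
    | zero => rfl
    | succ x => simp [Tm.liftRen, Var.toNat, Lrec.Tm.liftRen, h]
  | app t u iht ihu => simp [Tm.rename, Tm.compile, Lrec.Tm.rename, iht h, ihu h]
  | num n => exact ((closed_num n).rename_eq r).symm
  | succ => exact (closed_compileSucc.rename_eq r).symm
  | pred => exact (closed_compilePred.rename_eq r).symm
  | iszero => exact (closed_compileIszero.rename_eq r).symm
  | cond A => exact ((closed_compileCond _).rename_eq r).symm
  | fix A => exact ((closed_compileFix _).rename_eq r).symm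

/-- Compilation commutes with substitution, up to syntactic equality. -/
theorem Tm.compile_subst {Γ Δ : Ctx} {A : Ty} (t : Tm Γ A) {σ : ∀ A, Var Γ A → Tm Δ A}
    {τ : ℕ → Lrec.Tm} (h : ∀ A (x : Var Γ A), (σ A x).compile = τ x.toNat) :
    (t.subst σ).compile = t.compile.subst τ := by
  induction t generalizing Δ τ with
  | var x => exact h _ x
  | lam t ih =>
    rw [Tm.subst, Tm.compile_lam, Tm.compile_lam, subst_compileLam]
    congr 1
    refine ih fun A x => ?_
    cases x with
    | zero => rfl
    | succ x =>
      rw [Tm.liftSub, Tm.compile_rename (r := Nat.succ) _ fun _ _ => rfl, h]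
      rfl
  | app t u iht ihu => simp [Tm.subst, Tm.compile, Lrec.Tm.subst, iht h, ihu h]
  | num n => exact ((closed_num n).subst_eq τ).symm
  | succ => exact (closed_compileSucc.subst_eq τ).symm
  | pred => exact (closed_compilePred.subst_eq τ).symm
  | iszero => exact (closed_compileIszero.subst_eq τ).symm
  | cond A => exact ((closed_compileCond _).subst_eq τ).symm
  | fix A => exact ((closed_compileFix _).subst_eq τ).symm

theorem Tm.compile_inst {Γ : Ctx} {A B : Ty} (u : Tm (B :: Γ) A) (t : Tm Γ B) :
    (u.inst t).compile = u.compile.inst t.compile :=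
  Tm.compile_subst u fun _ x => by cases x <;> rfl

theorem Tm.lt_length_of_occurs {Γ : Ctx} {A : Ty} (t : Tm Γ A) {i : ℕ}
    (h : t.occurs i = true) : i < Γ.length := by
  have var : ∀ {Γ : Ctx} {A : Ty} (x : Var Γ A), x.toNat < Γ.length := by
    intro Γ A x
    induction x with
    | zero => simp [Var.toNat]
    | succ x ih => simpa [Var.toNat] using ih
  induction t generalizing i with
  | var x =>
    have h : i = x.toNat := by simpa [Tm.occurs] using h
    exact h ▸ var x
  | lam t ih => simpa using ih h
  | app t u iht ihu =>
    simp only [Tm.occurs, Bool.or_eq_true] at h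
    exact h.elim iht ihu
  | _ => simp [Tm.occurs] at h

theorem Tm.closed_compile {A : Ty} (t : Tm [] A) : t.compile.Closed := by
  intro i
  rw [Tm.occurs_compile, Bool.eq_false_iff]
  exact fun h => by simpa using t.lt_length_of_occurs h

/-- Compiled terms are linear up to the multiplicity of their free variables: an abstraction
linearizes the variable that it binds. -/
theorem Tm.linearOff_compile {Γ : Ctx} {A : Ty} (t : Tm Γ A) :
    LinearOff Set.univ t.compile := by
  have const : ∀ {s : Lrec.Tm}, s.Linear → s.Closed → LinearOff Set.univ s :=
    fun h hc => h.linearOff fun i _ => hc i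
  induction t with
  | var x => trivial
  | @lam Γ A B t ih =>
    have univ : shiftSet Set.univ = Set.univ \ {0} := by
      ext i; cases i <;> simp [shiftSet]
    rw [Tm.compile_lam, compileLam]
    split_ifs with h
    · refine ⟨?_, by rwa [occurs_linearize]⟩
      rw [univ]
      exact ih.linearize _ (Set.mem_univ 0) h
    · rw [Bool.not_eq_true] at h
      refine ⟨⟨⟨?_, ?_⟩, ih.congr fun i hi => ?_, ?_⟩, ?_⟩
      · simp [Linear, linear_I, FVDisjoint, closed_I _, Lrec.Tm.occurs, occurs_erase,
          linear_erase (t := .app (erase (.var 0) (.lolli B.compile B.compile)) (.var 1))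
            ⟨linear_erase (t := .var 0) trivial _, trivial, fun i => by
              simp [occurs_erase, Lrec.Tm.occurs]; omega⟩]
      · rintro i hi
        obtain ⟨i, -, rfl⟩ := hi
        simp [Lrec.Tm.occurs, occurs_erase, closed_I _]
      · have : i ≠ 0 := by rintro rfl; simp [h] at hi
        simp [univ, this]
      · rintro i hi ⟨-, hc⟩
        obtain rfl : i = 0 := by simpa [univ] using hi
        simp [h] at hc
      · simp [Lrec.Tm.occurs, occurs_erase]
  | app t u iht ihu => exact ⟨iht, ihu, fun i hi => absurd (Set.mem_univ i) hi⟩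
  | num n => exact const (linear_num n) (closed_num n)
  | succ => exact const linear_compileSucc closed_compileSucc
  | pred => exact const linear_compilePred closed_compilePred
  | iszero => exact const linear_compileIszero closed_compileIszero
  | cond A => exact const (linear_compileCond _) (closed_compileCond _)
  | fix A => exact const (linear_compileFix _) (closed_compileFix _)

theorem Tm.linear_compile {A : Ty} (t : Tm [] A) : t.compile.Linear :=
  linearOff_empty_iff.1 (t.linearOff_compile.congr fun i hi => by simp [t.closed_compile i] at hi)

/-! ### Soundness of the compilation -/

theorem red_compile_beta {A B : Ty} (u : Tm [A] B) (t : Tm [] A) :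
    Red (app (Tm.lam u).compile t.compile) (u.inst t).compile := by
  have ht := t.closed_compile
  rw [Tm.compile_inst, Tm.compile_lam, compileLam]
  split_ifs with h
  · exact .head (.beta ht) (red_subst_linearize A.compile (i := 0) ht u.compile)
  · have hu : (u.compile.inst t.compile).Closed := by
      rw [← Tm.compile_inst]; exact Tm.closed_compile _
    refine .head (.beta ht) (.trans (Red.app (red_recur_zero closed_zero ?_) .refl)
      (red_I_app hu))
    intro i
    simp [Lrec.Tm.subst, subst_erase, Lrec.Tm.occurs, occurs_erase, Lrec.Tm.liftSub, consSub,
      ht.rename_eq, ht _]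

theorem Eval.isValue {A : Ty} {t V : Tm [] A} (h : Eval t V) : IsValue V := by
  induction h with
  | val h => exact h
  | predZero | predSucc | succ | iszeroZero | iszeroSucc => exact .num _
  | app | beta | condZero | condSucc | fix => assumption

/-- Evaluation is sound for convertibility of the compiled terms. -/
theorem Eval.conv_compile {A : Ty} {t V : Tm [] A} (h : Eval t V) :
    Conv t.compile V.compile := by
  induction h with
  | @val A V h => exact Red.conv .refl V.linear_compile
  | @app A B s V' t V _ _ _ ih₁ ih₂ =>
    exact (ih₁.app_left t.linear_compile t.closed_compile).trans ih₂
  | @beta A B u t V _ ih =>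
    exact (Red.conv (red_compile_beta u t) (Tm.linear_compile (.app (.lam u) t))).trans ih
  | predZero _ ih =>
    have h := ih.app_right linear_compilePred closed_compilePred
    exact h.trans (Red.conv (red_compilePred 0) h.2.1)
  | @predSucc t n _ ih =>
    have h := ih.app_right linear_compilePred closed_compilePred
    exact h.trans (Red.conv (red_compilePred (n + 1)) h.2.1)
  | @succ t n _ ih =>
    have h := ih.app_right linear_compileSucc closed_compileSucc
    exact h.trans (Red.conv (red_compileSucc n) h.2.1)
  | iszeroZero _ ih =>
    have h := ih.app_right linear_compileIszero closed_compileIszero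
    exact h.trans (Red.conv (red_compileIszero 0) h.2.1)
  | @iszeroSucc t n _ ih =>
    have h := ih.app_right linear_compileIszero closed_compileIszero
    exact h.trans (Red.conv (red_compileIszero (n + 1)) h.2.1)
  | @condZero A t u v V _ _ iht ih =>
    have h := ((iht.app_right (linear_compileCond A.compile) (closed_compileCond _)).app_left
      u.linear_compile u.closed_compile).app_left v.linear_compile v.closed_compile
    exact (h.trans (Red.conv (red_compileCond_zero _ u.closed_compile v.closed_compile)
      h.2.1)).trans ih
  | @condSucc A t n u v V _ _ iht ih =>
    have h := ((iht.app_right (linear_compileCond A.compile) (closed_compileCond _)).app_left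
      u.linear_compile u.closed_compile).app_left v.linear_compile v.closed_compile
    exact (h.trans (Red.conv (red_compileCond_succ _ n u.closed_compile v.closed_compile)
      h.2.1)).trans ih
  | @fix A f V _ ih =>
    obtain ⟨r, h₁, h₂⟩ := exists_red_compileFix A.compile f.closed_compile
    exact ((Red.conv h₁ (Tm.linear_compile (.app (.fix A) f))).trans
      (Red.conv h₂ (Tm.linear_compile (.app f (.app (.fix A) f)))).symm).trans ih

/-- The compilation of a value is a value of `L_rec`, except that a partially applied conditional
has to be reduced to an abstraction. -/
theorem IsValue.exists_wHeads {A : Ty} {V : Tm [] A} (h : IsValue V) :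
    ∃ W, WHeads V.compile W ∧ Lrec.IsValue W := by
  cases h with
  | num n => cases n <;> exact ⟨_, .refl, by constructor⟩
  | lam t =>
    refine ⟨_, .refl, ?_⟩
    rw [Tm.compile_lam, compileLam]
    split_ifs <;> constructor
  | succ | pred | iszero | cond | fix => exact ⟨_, .refl, .lam _⟩
  | cond₁ t => exact ⟨_, .single (.beta t.closed_compile), .lam _⟩
  | cond₂ t u =>
    exact ⟨_, .head (.app (.beta t.closed_compile)) (.single (.beta u.closed_compile)), .lam _⟩

end PCF

theorem mainTheorem2 {A : PCF.Ty} (t V : PCF.Tm [] A) (h : PCF.Eval t V) :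
    ∃ V' : Lrec.Tm, Lrec.Eval t.compile V' ∧ Lrec.Conv V' V.compile := by
  obtain ⟨W, w, hW⟩ := h.isValue.exists_wHeads
  have c := Lrec.Red.conv w.red V.linear_compile
  obtain ⟨V', w', hV', c'⟩ := h.conv_compile.symm.exists_wHeads w hW
  exact ⟨V', ⟨t.linear_compile, t.closed_compile, w'.bigStep hV'⟩, (c.trans c').symm⟩
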